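/- Let $K_5-45$ be the complete graph on the vertex set $\{1,2,3,4,5\}$ with the edge $45$ deleted. A (piecewise-linear) map $f:K_5-45\to\mathbb R^2$ consists of a point $f(v)\in\mathbb R^2$ for every vertex $v$ and, for every edge $uv$, a polygonal line $f|_{uv}$ with finitely many segments joining $f(u)$ to $f(v)$ (passed in the reverse order when the edge is directed from $v$ to $u$); self-intersections and intersections are allowed, and $f(uv)$ denotes the union of the segments of $f|_{uv}$. The map $f$ is an almost embedding if the images of any two edges without a common vertex are disjoint, the image of a vertex never lies in the image of an edge not containing that vertex, and distinct vertices have distinct images. For a point $O$ not on a closed polygonal line $A_1\dots A_m$, the winding number of this line around $O$ is $$\frac1{2\pi}\bigl(\angle A_1OA_2+\dots+\angle A_{m-1}OA_m+\angle A_mOA_1\bigr),$$ where $\angle AOB\in(-\pi,\pi]$ is the oriented angle. Let $w_f(123,v)$ denote the winding number around $f(v)$ of the closed polygonal line formed by $f|_{12},f|_{23},f|_{31}$ in this order. Theorem. For any almost embedding $f:K_5-45\to\mathbb R^2$ the points $f(4)$ and $f(5)$ do not lie on $f(12)\cup f(23)\cup f(31)$, the numbers $w_f(123,4)$ and $w_f(123,5)$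 are integers, and (a) $w_f(123,4)-w_f(123,5)\equiv 1\pmod 2$; (b) $w_f(123,4)-w_f(123,5)=1$ or $w_f(123,4)-w_f(123,5)=-1$. -/

import Mathlib

noncomputable section

/-! The plane is `ℂ`. A polygonal line `A₁ … A_m` is the list `[A₁, …, A_m]` of its vertices. -/

/-- The oriented angle `∠AOB ∈ (-π, π]`: the vector `OB` is codirected with `e^{it} • OA`. -/
def orientedAngle (A O B : ℂ) : ℝ := Complex.arg ((B - O) / (A - O))

/-- The union of the segments `A₁A₂, …, A_{m-1}A_m` of the polygonal line `A₁ … A_m`. -/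
def polygonalImage (l : List ℂ) : Set ℂ :=
  {x | ∃ s ∈ l.zip l.tail, x ∈ segment ℝ s.1 s.2}

/-- The winding number around `O` of the closed polygonal line `A₁ … A_m`: the sum of the oriented
angles `∠A₁OA₂, …, ∠A_{m-1}OA_m, ∠A_mOA₁`, divided by `2π`. -/
def polygonalWinding (l : List ℂ) (O : ℂ) : ℝ :=
  (List.zipWith (fun A B => orientedAngle A O B) l (l.rotate 1)).sum / (2 * Real.pi)

/-- A piecewise-linear map of a graph to the plane: a point for every vertex, and for every edge a
polygonal line joining the images of its ends. The line is recorded for both orientations of the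
edge through the list of its intermediate vertices; the two lists are reverse to each other. -/
structure PLMap {V : Type*} (G : SimpleGraph V) where
  pos : V → ℂ
  inner : G.Dart → List ℂ
  inner_symm : ∀ d : G.Dart, inner d.symm = (inner d).reverse

namespace PLMap

variable {V : Type*} {G : SimpleGraph V}

/-- The restriction of the map to an oriented edge, as a polygonal line. -/
def line (f : PLMap G) (d : G.Dart) : List ℂ :=
  f.pos d.fst :: (f.inner d ++ [f.pos d.snd])

/-- The image of an edge. -/
def edgeImage (f : PLMap G) (d : G.Dart) : Set ℂ := polygonalImage (f.line d)

/-- Images of non-adjacent simplices (vertices or edges with no common vertex) are disjoint. -/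
structure IsAlmostEmbedding (f : PLMap G) : Prop where
  edge_edge : ∀ d e : G.Dart, (∀ v, v ∈ d.edge → v ∉ e.edge) →
    Disjoint (f.edgeImage d) (f.edgeImage e)
  vertex_edge : ∀ (v : V) (d : G.Dart), v ∉ d.edge → f.pos v ∉ f.edgeImage d
  vertex_vertex : ∀ u v : V, u ≠ v → f.pos u ≠ f.pos v

/-- The closed polygonal line formed by the polygonal lines of the consecutive edges of a directed
cycle; the last vertex of each line is dropped, being the first vertex of the next one. -/
def closedLine (f : PLMap G) {v : V} (C : G.Walk v v) : List ℂ :=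
  C.darts.flatMap fun d => (f.line d).dropLast

/-- The image of a directed cycle: the union of the images of its edges. -/
def cycleImage (f : PLMap G) {v : V} (C : G.Walk v v) : Set ℂ :=
  {x | ∃ d ∈ C.darts, x ∈ f.edgeImage d}

/-- `w_f(C, u)`, the winding number of `f|_C` around `f(u)`; meaningful if `f(u) ∉ f(C)`. -/
def winding (f : PLMap G) {v : V} (C : G.Walk v v) (u : V) : ℝ :=
  polygonalWinding (f.closedLine C) (f.pos u)

end PLMap

/-- `K₅` without the edge `45`; the vertices `1, 2, 3, 4, 5` are `0, 1, 2, 3, 4 : Fin 5`. -/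
def K5minus45 : SimpleGraph (Fin 5) := (⊤ : SimpleGraph (Fin 5)).deleteEdges {s(3, 4)}

theorem K5minus45_adj_01 : K5minus45.Adj 0 1 := by simp [K5minus45]

theorem K5minus45_adj_12 : K5minus45.Adj 1 2 := by simp [K5minus45]

theorem K5minus45_adj_20 : K5minus45.Adj 2 0 := by simp [K5minus45]

/-- The directed cycle `123`. -/
def cycle123 : K5minus45.Walk 0 0 :=
  .cons K5minus45_adj_01 (.cons K5minus45_adj_12 (.cons K5minus45_adj_20 .nil))

end

noncomputable section

open unitInterval

/-! ### Variation of the logarithm along a path -/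

/-! Put A = f(4), B = f(5). The logarithm of (p - A)/(p - B) unrolls the plane without A and B into
a plane with the period 2πi. Going once around the triangle 123, the lift moves by 2πi·d, where d is
the difference of the two winding numbers. For i = 1, 2, 3 the path from A to B through the vertex i
lifts, apart from pieces near its ends, to a `Strand` crossing a vertical strip from left to right.
Call these strands X, Y, Z and their marked points x, y, z.

Seen from a point off it, a strand makes an odd number of half-turns (`halfTurns`): 1 if it runs
below the point, -1 if above. Three facts carry the proof. Invariance (`halfTurns_eq_of_path`): the
number is constant along paths off the strand, and each side of the triangle is such a path for the
opposite strand. Antisymmetry (`halfTurns_antisymm`): X around y and Y around x give opposite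
numbers. Only the disjointness of the edges 4i and 5j is used; 4i and 4j may cross. Transitivity
(`halfTurns_trans`): if Y runs above x and Z above y, then Z runs above x. This is the hard part; it
is proved by taking logarithms once more, now centred at y.

Let a(k) be the number of half-turns around x of Y shifted by k periods. Invariance and antisymmetry
give a(-k) = -a(k - d). Also, Z shifted by 2k lies relative to Y shifted by k as the latter lies
relative to X, so by transitivity a(2k) has the sign of a(k). Since a is positive far down and
negative far up, its sign changes only at 0, and the reflection forces d = 1 or d = -1
(`Int.eq_one_or_neg_one_of_odd_reflection`). -/

theorem exists_continuous_log_of_retract {X E : Type*} [TopologicalSpace X] [TopologicalSpace E]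
    [SimplyConnectedSpace E] [LocallyPathConnectedSpace E] {r : E → X} {i : X → E}
    (hr : Continuous r) (hi : Continuous i) (hri : ∀ x, r (i x) = x)
    {g : X → ℂ} (hg : Continuous g) (h0 : ∀ x, g x ≠ 0) :
    ∃ l : X → ℂ, Continuous l ∧ ∀ x, Complex.exp (l x) = g x := by
  obtain ⟨e⟩ : Nonempty E := inferInstance
  -- The lift is taken for g ∘ r on E; restricting it along i undoes r.
  obtain ⟨l, ⟨-, hl⟩, -⟩ := Complex.isCoveringMapOn_exp.existsUnique_continuousMap_lifts
    (f := ⟨g ∘ r, hg.comp hr⟩) (a₀ := e) (e₀ := Complex.log (g (r e)))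
    (Complex.exp_log (h0 (r e))) (fun x => h0 (r x))
  refine ⟨l ∘ i, l.continuous.comp hi, fun x => ?_⟩
  have := congrFun hl (i x)
  simpa [hri] using this

theorem exists_continuous_log {g : I → ℂ} (hg : Continuous g) (h0 : ∀ x, g x ≠ 0) :
    ∃ l : I → ℂ, Continuous l ∧ ∀ x, Complex.exp (l x) = g x :=
  exists_continuous_log_of_retract (E := ℝ) (r := Set.projIcc 0 1 zero_le_one)
    (i := Subtype.val) continuous_projIcc continuous_subtype_val
    (fun x => Set.projIcc_val zero_le_one x) hg h0

theorem exists_continuous_log_square {g : I × I → ℂ} (hg : Continuous g) (h0 : ∀ x, g x ≠ 0) :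
    ∃ l : I × I → ℂ, Continuous l ∧ ∀ x, Complex.exp (l x) = g x :=
  exists_continuous_log_of_retract (E := ℝ × ℝ)
    (r := Prod.map (Set.projIcc 0 1 zero_le_one) (Set.projIcc 0 1 zero_le_one))
    (i := Prod.map Subtype.val Subtype.val) (continuous_projIcc.prodMap continuous_projIcc)
    (continuous_subtype_val.prodMap continuous_subtype_val)
    (fun x => by ext <;> simp [Set.projIcc_val]) hg h0

/-- Two continuous logarithms of the same path differ by a constant. -/
theorem sub_eq_sub_of_exp_eq {l m : I → ℂ} (hl : Continuous l) (hm : Continuous m)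
    (h : ∀ t, Complex.exp (l t) = Complex.exp (m t)) (s t : I) : l s - m s = l t - m t := by
  have h1 : ∀ t, ∃ n : ℤ, l t - m t = n * (2 * Real.pi * Complex.I) := fun t => by
    obtain ⟨n, hn⟩ := Complex.exp_eq_exp_iff_exists_int.1 (h t)
    exact ⟨n, by rw [hn]; ring⟩
  choose n hn using h1
  have hpi : (2 * Real.pi * Complex.I : ℂ) ≠ 0 := Complex.two_pi_I_ne_zero
  have hc : Continuous n := by
    rw [Int.isClosedEmbedding_coe_real.isEmbedding.continuous_iff]
    have : (Int.cast ∘ n : I → ℝ) = fun t => ((l t - m t) / (2 * Real.pi * Complex.I)).re := by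
      ext t
      rw [hn, mul_div_cancel_right₀ _ hpi]
      simp
    rw [this]
    exact Complex.continuous_re.comp ((hl.sub hm).div_const _)
  rw [hn, hn, PreconnectedSpace.constant inferInstance hc]

open Classical in
/-- The variation of the logarithm of a nowhere zero path. -/
def logVar (g : I → ℂ) : ℂ :=
  if h : ∃ l : I → ℂ, Continuous l ∧ ∀ t, Complex.exp (l t) = g t then
    h.choose 1 - h.choose 0 else 0

/-- Makes the choice in `logVar` harmless: every continuous logarithm computes it. -/
theorem logVar_eq {g l : I → ℂ} (hl : Continuous l) (h : ∀ t, Complex.exp (l t) = g t) :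
    logVar g = l 1 - l 0 := by
  have hex : ∃ l : I → ℂ, Continuous l ∧ ∀ t, Complex.exp (l t) = g t := ⟨l, hl, h⟩
  rw [logVar, dif_pos hex]
  have := sub_eq_sub_of_exp_eq hex.choose_spec.1 hl
    (fun t => (hex.choose_spec.2 t).trans (h t).symm) 1 0
  linear_combination this

theorem exp_logVar {g : I → ℂ} (hg : Continuous g) (h0 : ∀ t, g t ≠ 0) :
    Complex.exp (logVar g) = g 1 / g 0 := by
  obtain ⟨l, hl, h⟩ := exists_continuous_log hg h0
  rw [logVar_eq hl h, Complex.exp_sub, h, h]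

theorem logVar_mul {f g : I → ℂ} (hf : Continuous f) (hf0 : ∀ t, f t ≠ 0)
    (hg : Continuous g) (hg0 : ∀ t, g t ≠ 0) :
    logVar (fun t => f t * g t) = logVar f + logVar g := by
  obtain ⟨l, hl, h⟩ := exists_continuous_log hf hf0
  obtain ⟨m, hm, h'⟩ := exists_continuous_log hg hg0
  rw [logVar_eq hl h, logVar_eq hm h',
    logVar_eq (l := fun t => l t + m t) (hl.add hm) (fun t => by rw [Complex.exp_add, h, h'])]
  ring

theorem logVar_div {f g : I → ℂ} (hf : Continuous f) (hf0 : ∀ t, f t ≠ 0)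
    (hg : Continuous g) (hg0 : ∀ t, g t ≠ 0) :
    logVar (fun t => f t / g t) = logVar f - logVar g := by
  obtain ⟨l, hl, h⟩ := exists_continuous_log hf hf0
  obtain ⟨m, hm, h'⟩ := exists_continuous_log hg hg0
  rw [logVar_eq hl h, logVar_eq hm h',
    logVar_eq (l := fun t => l t - m t) (hl.sub hm) (fun t => by rw [Complex.exp_sub, h, h'])]
  ring

theorem logVar_const_mul {c : ℂ} (hc : c ≠ 0) {g : I → ℂ} (hg : Continuous g)
    (hg0 : ∀ t, g t ≠ 0) : logVar (fun t => c * g t) = logVar g := by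
  obtain ⟨l, hl, h⟩ := exists_continuous_log hg hg0
  rw [logVar_eq hl h, logVar_eq (l := fun t => Complex.log c + l t) (continuous_const.add hl)
    (fun t => by rw [Complex.exp_add, h, Complex.exp_log hc])]
  ring

theorem logVar_sub_comm {f g : I → ℂ} (hf : Continuous f) (hg : Continuous g)
    (h0 : ∀ t, f t ≠ g t) : logVar (fun t => f t - g t) = logVar (fun t => g t - f t) := by
  rw [← logVar_const_mul (c := -1) (g := fun t => g t - f t) (by norm_num) (hg.sub hf)
    (fun t => sub_ne_zero.2 (h0 t).symm)]
  simp

theorem logVar_of_mem_slitPlane {g : I → ℂ} (hg : Continuous g)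
    (h : ∀ t, g t ∈ Complex.slitPlane) :
    logVar g = Complex.log (g 1) - Complex.log (g 0) :=
  logVar_eq (l := fun t => Complex.log (g t)) (hg.clog h)
    (fun t => Complex.exp_log (Complex.slitPlane_ne_zero (h t)))

/-- The variation of the logarithm around the boundary of a square is zero. -/
theorem logVar_square {G : I × I → ℂ} (hG : Continuous G) (h0 : ∀ x, G x ≠ 0) :
    logVar (fun t => G (0, t)) + logVar (fun s => G (s, 1)) =
      logVar (fun s => G (s, 0)) + logVar (fun t => G (1, t)) := by
  obtain ⟨l, hl, h⟩ := exists_continuous_log_square hG h0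
  rw [logVar_eq (l := fun t => l (0, t)) (by fun_prop) (fun t => h _),
    logVar_eq (l := fun t => l (t, 1)) (by fun_prop) (fun t => h _),
    logVar_eq (l := fun t => l (t, 0)) (by fun_prop) (fun t => h _),
    logVar_eq (l := fun t => l (1, t)) (by fun_prop) (fun t => h _)]
  ring

theorem continuous_logVar {G : I × I → ℂ} (hG : Continuous G) (h0 : ∀ x, G x ≠ 0) :
    Continuous fun s => logVar fun t => G (s, t) := by
  obtain ⟨l, hl, h⟩ := exists_continuous_log_square hG h0
  have : (fun s => logVar fun t => G (s, t)) = fun s => l (s, 1) - l (s, 0) := by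
    ext s
    rw [logVar_eq (l := fun t => l (s, t)) (by fun_prop) (fun t => h _)]
  rw [this]
  fun_prop

/-- The square formula for the vectors between the points of two disjoint paths. -/
theorem logVar_sub_square {f g : I → ℂ} (hf : Continuous f) (hg : Continuous g)
    (h : ∀ s t, f s ≠ g t) :
    logVar (fun t => g t - f 0) + logVar (fun s => f s - g 1) =
      logVar (fun s => f s - g 0) + logVar (fun t => g t - f 1) := by
  have := logVar_square (G := fun x => g x.2 - f x.1) (by fun_prop)
    (fun x => sub_ne_zero.2 (h x.1 x.2).symm)
  rw [logVar_sub_comm hf continuous_const (fun s => h s 1),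
    logVar_sub_comm hf continuous_const (fun s => h s 0)]
  exact this

theorem logVar_path_trans {a b c : ℂ} (γ : Path a b) (δ : Path b c) {p : ℂ}
    (hγ : ∀ t, γ t ≠ p) (hδ : ∀ t, δ t ≠ p) :
    logVar (fun t => γ.trans δ t - p) =
      logVar (fun t => γ t - p) + logVar (fun t => δ t - p) := by
  have h0 : ∀ t, γ.trans δ t - p ≠ 0 := fun t => by
    have : γ.trans δ t ∈ Set.range γ ∪ Set.range δ := by
      rw [← Path.trans_range]; exact ⟨t, rfl⟩
    rcases this with ⟨s, hs⟩ | ⟨s, hs⟩ <;> rw [← hs, sub_ne_zero]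
    exacts [hγ s, hδ s]
  obtain ⟨l, hl, h⟩ := exists_continuous_log (g := fun t => γ.trans δ t - p)
    ((γ.trans δ).continuous.sub continuous_const) h0
  -- One logarithm of the whole path, reparametrised on the two halves of the interval, serves both
  -- pieces.
  let u : I → I := fun t => ⟨(t : ℝ) / 2, by have := t.2.1; positivity, by linarith [t.2.2]⟩
  let v : I → I := fun t => ⟨((t : ℝ) + 1) / 2, by have := t.2.1; positivity, by linarith [t.2.2]⟩
  have hu : Continuous u := by fun_prop
  have hv : Continuous v := by fun_prop
  have eu : ∀ t, γ.trans δ (u t) = γ t := fun t => by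
    rw [Path.trans_apply, dif_pos (by show (t : ℝ) / 2 ≤ 1 / 2; linarith [t.2.2])]
    congr 1
    ext
    show 2 * ((t : ℝ) / 2) = t
    ring
  have ev : ∀ t, γ.trans δ (v t) = δ t := fun t => by
    rw [Path.trans_apply]
    split_ifs with ht
    -- At t = 0 the parameter is 1/2, which `Path.trans` assigns to its first branch; the branches
    -- agree there.
    · have ht0 : t = 0 := by
        ext
        have : ((t : ℝ) + 1) / 2 ≤ 1 / 2 := ht
        have := t.2.1
        show (t : ℝ) = 0
        linarith
      subst ht0
      simp [v]
    · congr 1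
      ext
      show 2 * (((t : ℝ) + 1) / 2) - 1 = t
      ring
  rw [logVar_eq hl h, logVar_eq (hl.comp hu) (fun t => by rw [Function.comp, h, eu]),
    logVar_eq (hl.comp hv) (fun t => by rw [Function.comp, h, ev])]
  have e0 : u 0 = 0 := by ext; simp [u]
  have e1 : v 1 = 1 := by ext; simp [v]
  have e2 : u 1 = v 0 := by ext; simp [u, v]
  simp only [Function.comp, e0, e1, e2]
  ring

/-! ### Strands -/

/-- A path from the half-plane `re ≤ -R` to the half-plane `R ≤ re` with a marked point, which is
the end of the path `α` and the start of the path `β`; the first path stays to the left of the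
second half-plane, the second path stays to the right of the first one. -/
structure Strand (R : ℝ) where
  α : I → ℂ
  β : I → ℂ
  continuous_α : Continuous α
  continuous_β : Continuous β
  join : α 1 = β 0
  left : (α 0).re ≤ -R
  right : R ≤ (β 1).re
  re_α_lt : ∀ t, (α t).re < R
  lt_re_β : ∀ t, -R < (β t).re

theorem Complex.log_I_mul_of_re_pos {w : ℂ} (hr : 0 < w.re) :
    Complex.log (Complex.I * w) = Complex.log w + Real.pi / 2 * Complex.I := by
  have hw : w ≠ 0 := fun h => by simp [h] at hr
  have ha := Complex.abs_arg_lt_pi_div_two_iff.2 (Or.inl hr)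
  rw [abs_lt] at ha
  rw [add_comm, ← Complex.log_I, Complex.log_mul Complex.I_ne_zero hw]
  rw [Complex.arg_I]
  constructor <;> linarith [Real.pi_pos]

theorem Complex.log_neg_I_mul_of_re_pos {w : ℂ} (hr : 0 < w.re) :
    Complex.log (-Complex.I * w) = Complex.log w - Real.pi / 2 * Complex.I := by
  have hw : w ≠ 0 := fun h => by simp [h] at hr
  have ha := Complex.abs_arg_lt_pi_div_two_iff.2 (Or.inl hr)
  rw [abs_lt] at ha
  rw [sub_eq_neg_add, ← neg_mul, ← Complex.log_neg_I,
    Complex.log_mul (neg_ne_zero.2 Complex.I_ne_zero) hw]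
  rw [Complex.arg_neg_I]
  constructor <;> linarith [Real.pi_pos]

namespace Strand

variable {R : ℝ}

/-- The marked point. -/
def vert (X : Strand R) : ℂ := X.α 1

theorem vert_eq (X : Strand R) : X.vert = X.β 0 := X.join

theorem vert_re_lt (X : Strand R) : X.vert.re < R := X.re_α_lt 1

theorem lt_vert_re (X : Strand R) : -R < X.vert.re := by
  rw [vert_eq]; exact X.lt_re_β 0

/-- The strand does not pass through the point `p`. -/
def Avoids (X : Strand R) (p : ℂ) : Prop := (∀ t, X.α t ≠ p) ∧ ∀ t, X.β t ≠ p

/-- The first part of each of two strands is disjoint from the second part of the other one. -/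
def Compat (X Y : Strand R) : Prop := (∀ s t, X.α s ≠ Y.β t) ∧ ∀ s t, Y.α s ≠ X.β t

theorem Compat.symm {X Y : Strand R} (h : X.Compat Y) : Y.Compat X := ⟨h.2, h.1⟩

theorem Compat.avoids {X Y : Strand R} (h : X.Compat Y) : X.Avoids Y.vert :=
  ⟨fun t => by rw [vert_eq]; exact h.1 t 0, fun t => (h.2 1 t).symm⟩

/-- The variation of the logarithm along a strand seen from a point, corrected by the principal
values at the ends. -/
def turn (X : Strand R) (p : ℂ) : ℂ :=
  logVar (fun t => X.α t - p) + logVar (fun t => X.β t - p) -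
    Complex.log (X.β 1 - p) + Complex.log (p - X.α 0)

/-- The rotation of a strand seen from a point, in half-turns. -/
def halfTurns (X : Strand R) (p : ℂ) : ℤ := round (X.turn p / (Real.pi * Complex.I)).re

/-- Under exp the variations telescope to (β 1 - p)/(α 0 - p), and the corrections turn this into
-1; the logarithms of -1 are the odd multiples of πi. -/
theorem exists_turn_eq (X : Strand R) {p : ℂ} (h : X.Avoids p) :
    ∃ n : ℤ, X.turn p = (2 * n + 1 : ℤ) * (Real.pi * Complex.I) := by
  have h1 : Complex.exp (X.turn p) = Complex.exp (Real.pi * Complex.I) := by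
    have e1 : X.α 1 - p ≠ 0 := sub_ne_zero.2 (h.1 1)
    have e2 : X.α 0 - p ≠ 0 := sub_ne_zero.2 (h.1 0)
    have e3 : X.β 1 - p ≠ 0 := sub_ne_zero.2 (h.2 1)
    have e4 : p - X.α 0 ≠ 0 := sub_ne_zero.2 (h.1 0).symm
    rw [turn, Complex.exp_add, Complex.exp_sub, Complex.exp_add, Complex.exp_log e3,
      Complex.exp_log e4,
      exp_logVar (g := fun t => X.α t - p) (X.continuous_α.sub continuous_const) (fun t => sub_ne_zero.2 (h.1 t)),
      exp_logVar (g := fun t => X.β t - p) (X.continuous_β.sub continuous_const) (fun t => sub_ne_zero.2 (h.2 t)),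
      ← X.join, Complex.exp_pi_mul_I]
    field_simp
    ring
  obtain ⟨n, hn⟩ := Complex.exp_eq_exp_iff_exists_int.1 h1
  exact ⟨n, by rw [hn]; push_cast; ring⟩

/-- For a point off the strand the rounding in `halfTurns` is therefore exact. -/
theorem turn_eq (X : Strand R) {p : ℂ} (h : X.Avoids p) :
    X.turn p = X.halfTurns p * (Real.pi * Complex.I) ∧ Odd (X.halfTurns p) := by
  obtain ⟨n, hn⟩ := X.exists_turn_eq h
  have hpi : (Real.pi * Complex.I : ℂ) ≠ 0 := by simp [Real.pi_ne_zero]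
  have : X.halfTurns p = 2 * n + 1 := by
    rw [halfTurns, hn, mul_div_cancel_right₀ _ hpi, Complex.intCast_re, round_intCast]
  rw [this]
  exact ⟨hn, n, rfl⟩

theorem halfTurns_of_turn_eq {X : Strand R} {p : ℂ} {n : ℤ}
    (h : X.turn p = n * (Real.pi * Complex.I)) : X.halfTurns p = n := by
  have hpi : (Real.pi * Complex.I : ℂ) ≠ 0 := by simp [Real.pi_ne_zero]
  rw [halfTurns, h, mul_div_cancel_right₀ _ hpi, Complex.intCast_re, round_intCast]

/-- The rotation does not change when the point moves off the strand. -/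
theorem halfTurns_eq_of_path (X : Strand R) {γ : I → ℂ} (hγ : Continuous γ)
    (hl : ∀ t, -R < (γ t).re) (hr : ∀ t, (γ t).re < R) (h : ∀ t, X.Avoids (γ t)) :
    X.halfTurns (γ 0) = X.halfTurns (γ 1) := by
  have e1 := logVar_sub_square hγ X.continuous_α (fun s t => ((h s).1 t).symm)
  have e2 := logVar_sub_square hγ X.continuous_β (fun s t => ((h s).2 t).symm)
  -- The ends of the strand lie outside the open strip, so seen from them γ stays in a half-plane,
  -- and the variation is exactly the change of the correction terms in `turn`.
  have e3 : logVar (fun s => γ s - X.α 0) =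
      Complex.log (γ 1 - X.α 0) - Complex.log (γ 0 - X.α 0) :=
    logVar_of_mem_slitPlane (g := fun s => γ s - X.α 0) (by fun_prop)
      (fun t => Or.inl (by simp; linarith [hl t, X.left]))
  have e4 : logVar (fun s => γ s - X.β 1) =
      Complex.log (X.β 1 - γ 1) - Complex.log (X.β 1 - γ 0) := by
    rw [logVar_sub_comm hγ continuous_const (fun t => ((h t).2 1).symm)]
    exact logVar_of_mem_slitPlane (g := fun s => X.β 1 - γ s) (by fun_prop)
      (fun t => Or.inl (by simp; linarith [hr t, X.right]))
  rw [halfTurns, halfTurns]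
  congr 3
  rw [turn, turn]
  rw [X.join] at e1
  rw [e3] at e1
  rw [e4] at e2
  linear_combination e1 + e2

/-- The square formula for the first part of X and the second part of Y: the two sides of the square
involving an outer end are differences of principal logarithms. Adding the formula with X and Y
exchanged gives antisymmetry, since all four variations then occur. -/
theorem logVar_α_add_logVar_β {X Y : Strand R} (h : ∀ s t, X.α s ≠ Y.β t) :
    logVar (fun s => X.α s - Y.vert) + logVar (fun t => Y.β t - X.vert) =
      Complex.log (Y.β 1 - X.vert) - Complex.log (Y.vert - X.α 0) := by
  have e1 := logVar_sub_square X.continuous_α Y.continuous_β h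
  have e3 : logVar (fun t => Y.β t - X.α 0) =
      Complex.log (Y.β 1 - X.α 0) - Complex.log (Y.β 0 - X.α 0) :=
    logVar_of_mem_slitPlane (g := fun t => Y.β t - X.α 0)
      (Y.continuous_β.sub continuous_const)
      (fun t => Or.inl (by simp; linarith [Y.lt_re_β t, X.left]))
  have e4 : logVar (fun s => X.α s - Y.β 1) =
      Complex.log (Y.β 1 - X.α 1) - Complex.log (Y.β 1 - X.α 0) := by
    rw [logVar_sub_comm X.continuous_α continuous_const (fun t => h t 1)]
    exact logVar_of_mem_slitPlane (g := fun s => Y.β 1 - X.α s)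
      (continuous_const.sub X.continuous_α)
      (fun t => Or.inl (by simp; linarith [X.re_α_lt t, Y.right]))
  rw [Y.vert_eq, vert]
  linear_combination -e1 + e3 + e4

theorem halfTurns_antisymm {X Y : Strand R} (h : X.Compat Y) :
    X.halfTurns Y.vert = - Y.halfTurns X.vert := by
  have e1 := logVar_α_add_logVar_β h.1
  have e2 := logVar_α_add_logVar_β h.2
  apply halfTurns_of_turn_eq
  rw [Int.cast_neg, neg_mul, ← (Y.turn_eq h.symm.avoids).1, turn, turn]
  linear_combination e1 + e2

/-- Multiplication by i moves the lower half-plane to the right one, where the principal logarithm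
is continuous; the quarter-turns at the two ends add up to πi. -/
theorem halfTurns_of_im_lt (X : Strand R) {p : ℂ} (hl : -R < p.re) (hr : p.re < R)
    (hα : ∀ t, (X.α t).im < p.im) (hβ : ∀ t, (X.β t).im < p.im) : X.halfTurns p = 1 := by
  have key : ∀ {g : I → ℂ}, Continuous g → (∀ t, (g t).im < p.im) →
      logVar (fun t => g t - p) =
        Complex.log (Complex.I * (g 1 - p)) - Complex.log (Complex.I * (g 0 - p)) := by
    intro g hg h
    rw [← logVar_const_mul Complex.I_ne_zero (g := fun t => g t - p) (hg.sub continuous_const)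
      (fun t ht => by have := h t; rw [sub_eq_zero.1 ht] at this; exact lt_irrefl _ this)]
    exact logVar_of_mem_slitPlane (g := fun t => Complex.I * (g t - p)) (by fun_prop)
      (fun t => Or.inl (by simpa using h t))
  apply halfTurns_of_turn_eq
  have e1 := Complex.log_I_mul_of_re_pos (w := X.β 1 - p)
    (by simp; linarith [X.right])
  have e2 := Complex.log_neg_I_mul_of_re_pos (w := p - X.α 0)
    (by simp; linarith [X.left])
  have e3 : Complex.I * (X.α 0 - p) = -Complex.I * (p - X.α 0) := by ring
  rw [turn, key X.continuous_α hα, key X.continuous_β hβ, e1, e3, e2, X.join]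
  push_cast
  ring

theorem halfTurns_of_lt_im (X : Strand R) {p : ℂ} (hl : -R < p.re) (hr : p.re < R)
    (hα : ∀ t, p.im < (X.α t).im) (hβ : ∀ t, p.im < (X.β t).im) : X.halfTurns p = -1 := by
  have key : ∀ {g : I → ℂ}, Continuous g → (∀ t, p.im < (g t).im) →
      logVar (fun t => g t - p) =
        Complex.log (-Complex.I * (g 1 - p)) - Complex.log (-Complex.I * (g 0 - p)) := by
    intro g hg h
    rw [← logVar_const_mul (neg_ne_zero.2 Complex.I_ne_zero) (g := fun t => g t - p)
      (hg.sub continuous_const)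
      (fun t ht => by have := h t; rw [sub_eq_zero.1 ht] at this; exact lt_irrefl _ this)]
    exact logVar_of_mem_slitPlane (g := fun t => -Complex.I * (g t - p)) (by fun_prop)
      (fun t => Or.inl (by simpa using h t))
  apply halfTurns_of_turn_eq
  have e1 := Complex.log_neg_I_mul_of_re_pos (w := X.β 1 - p)
    (by simp; linarith [X.right])
  have e2 := Complex.log_I_mul_of_re_pos (w := p - X.α 0)
    (by simp; linarith [X.left])
  have e3 : -Complex.I * (X.α 0 - p) = Complex.I * (p - X.α 0) := by ring
  rw [turn, key X.continuous_α hα, key X.continuous_β hβ, e1, e3, e2, X.join]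
  push_cast
  ring

/-- The strand shifted by `2πik`. -/
def shift (X : Strand R) (k : ℤ) : Strand R where
  α t := X.α t + k * (2 * Real.pi * Complex.I)
  β t := X.β t + k * (2 * Real.pi * Complex.I)
  continuous_α := X.continuous_α.add continuous_const
  continuous_β := X.continuous_β.add continuous_const
  join := by rw [X.join]
  left := by simpa using X.left
  right := by simpa using X.right
  re_α_lt t := by simpa using X.re_α_lt t
  lt_re_β t := by simpa using X.lt_re_β t

theorem shift_vert (X : Strand R) (k : ℤ) :
    (X.shift k).vert = X.vert + k * (2 * Real.pi * Complex.I) := rfl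

theorem shift_shift (X : Strand R) (k l : ℤ) : (X.shift k).shift l = X.shift (k + l) := by
  simp only [shift, mk.injEq]
  constructor <;> ext t <;> push_cast <;> ring

theorem shift_zero (X : Strand R) : X.shift 0 = X := by
  simp [shift]

theorem halfTurns_shift (X : Strand R) (k : ℤ) (p : ℂ) :
    (X.shift k).halfTurns (p + k * (2 * Real.pi * Complex.I)) = X.halfTurns p := by
  simp only [halfTurns, turn, shift, add_sub_add_right_eq_sub]

/-- The first part of a strand as a path. -/
def pathα (X : Strand R) : Path (X.α 0) X.vert := ⟨⟨X.α, X.continuous_α⟩, rfl, rfl⟩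

/-- The second part of a strand as a path. -/
def pathβ (X : Strand R) : Path X.vert (X.β 1) := ⟨⟨X.β, X.continuous_β⟩, X.vert_eq.symm, rfl⟩

theorem segment_trans_pathα_apply (X : Strand R) (a : ℂ) (t : I) :
    (Path.segment a (X.α 0)).trans X.pathα t ∈ segment ℝ a (X.α 0) ∨
      ∃ s, (Path.segment a (X.α 0)).trans X.pathα t = X.α s := by
  have : (Path.segment a (X.α 0)).trans X.pathα t ∈
      Set.range (Path.segment a (X.α 0)) ∪ Set.range X.pathα := by
    rw [← Path.trans_range]; exact ⟨t, rfl⟩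
  rw [Path.range_segment] at this
  exact this.imp id (fun ⟨s, hs⟩ => ⟨s, hs.symm⟩)

theorem pathβ_trans_segment_apply (X : Strand R) (b : ℂ) (t : I) :
    X.pathβ.trans (Path.segment (X.β 1) b) t ∈ segment ℝ (X.β 1) b ∨
      ∃ s, X.pathβ.trans (Path.segment (X.β 1) b) t = X.β s := by
  have : X.pathβ.trans (Path.segment (X.β 1) b) t ∈
      Set.range X.pathβ ∪ Set.range (Path.segment (X.β 1) b) := by
    rw [← Path.trans_range]; exact ⟨t, rfl⟩
  rw [Path.range_segment] at this
  exact this.symm.imp id (fun ⟨s, hs⟩ => ⟨s, hs.symm⟩)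

theorem re_le_of_mem_segment {a b z : ℂ} {r : ℝ} (ha : a.re ≤ r) (hb : b.re ≤ r)
    (hz : z ∈ segment ℝ a b) : z.re ≤ r :=
  (convex_halfSpace_re_le r).segment_subset ha hb hz

theorem le_re_of_mem_segment {a b z : ℂ} {r : ℝ} (ha : r ≤ a.re) (hb : r ≤ b.re)
    (hz : z ∈ segment ℝ a b) : r ≤ z.re :=
  (convex_halfSpace_re_ge r).segment_subset ha hb hz

/-- The strand with its ends joined by segments to new ends. -/
def extend (X : Strand R) (a b : ℂ) (ha : a.re ≤ -R) (hb : R ≤ b.re) : Strand R where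
  α := (Path.segment a (X.α 0)).trans X.pathα
  β := X.pathβ.trans (Path.segment (X.β 1) b)
  continuous_α := Path.continuous _
  continuous_β := Path.continuous _
  join := by rw [Path.source, Path.target]
  left := by rw [Path.source]; exact ha
  right := by rw [Path.target]; exact hb
  re_α_lt t := by
    rcases X.segment_trans_pathα_apply a t with h | ⟨s, hs⟩
    · have := re_le_of_mem_segment ha X.left h
      linarith [X.vert_re_lt, X.lt_vert_re]
    · rw [hs]; exact X.re_α_lt s
  lt_re_β t := by
    rcases X.pathβ_trans_segment_apply b t with h | ⟨s, hs⟩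
    · have := le_re_of_mem_segment X.right hb h
      linarith [X.vert_re_lt, X.lt_vert_re]
    · rw [hs]; exact X.lt_re_β s

section extend

variable (X : Strand R) (a b : ℂ) (ha : a.re ≤ -R) (hb : R ≤ b.re)

theorem extend_α_zero : (X.extend a b ha hb).α 0 = a := Path.source _

theorem extend_β_one : (X.extend a b ha hb).β 1 = b := Path.target _

theorem extend_vert : (X.extend a b ha hb).vert = X.vert := Path.target _

theorem extend_α_cases (t : I) : (X.extend a b ha hb).α t ∈ segment ℝ a (X.α 0) ∨
    ∃ s, (X.extend a b ha hb).α t = X.α s := X.segment_trans_pathα_apply a t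

theorem extend_β_cases (t : I) : (X.extend a b ha hb).β t ∈ segment ℝ (X.β 1) b ∨
    ∃ s, (X.extend a b ha hb).β t = X.β s := X.pathβ_trans_segment_apply b t

theorem extend_α_ne_extend_β {Y : Strand R} {a' b' : ℂ} (ha' : a'.re ≤ -R) (hb' : R ≤ b'.re)
    (h : ∀ s t, X.α s ≠ Y.β t) (s t : I) :
    (X.extend a b ha hb).α s ≠ (Y.extend a' b' ha' hb').β t := by
  intro e
  have h1 := (X.extend a b ha hb).re_α_lt s
  have h2 := (Y.extend a' b' ha' hb').lt_re_β t
  rcases X.extend_α_cases a b ha hb s with h3 | ⟨s', hs⟩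
  · have := re_le_of_mem_segment ha X.left h3
    rw [e] at this
    linarith
  · rcases Y.extend_β_cases a' b' ha' hb' t with h4 | ⟨t', ht⟩
    · have := le_re_of_mem_segment Y.right hb' h4
      rw [← e] at this
      linarith
    · exact h s' t' (by rw [← hs, ← ht, e])

variable {X}

theorem Compat.extend {Y : Strand R} (h : X.Compat Y) {a' b' : ℂ} (ha' : a'.re ≤ -R)
    (hb' : R ≤ b'.re) : (X.extend a b ha hb).Compat (Y.extend a' b' ha' hb') :=
  ⟨X.extend_α_ne_extend_β a b ha hb ha' hb' h.1, Y.extend_α_ne_extend_β a' b' ha' hb' ha hb h.2⟩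

/-- Each added segment stays on one side of p, so the variation along it cancels against the change
of the correction term. -/
theorem halfTurns_extend {p : ℂ} (hl : -R < p.re) (hr : p.re < R) (h : X.Avoids p) :
    (X.extend a b ha hb).halfTurns p = X.halfTurns p := by
  have nl : ∀ t, Path.segment a (X.α 0) t ∈ segment ℝ a (X.α 0) := fun t => by
    rw [← Path.range_segment]; exact ⟨t, rfl⟩
  have nr : ∀ t, Path.segment (X.β 1) b t ∈ segment ℝ (X.β 1) b := fun t => by
    rw [← Path.range_segment]; exact ⟨t, rfl⟩
  have nl' : ∀ t, 0 < (p - Path.segment a (X.α 0) t).re := fun t => by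
    have := re_le_of_mem_segment ha X.left (nl t)
    rw [Complex.sub_re]; linarith
  have nr' : ∀ t, 0 < (Path.segment (X.β 1) b t - p).re := fun t => by
    have := le_re_of_mem_segment X.right hb (nr t)
    rw [Complex.sub_re]; linarith
  have e0 : logVar (fun t => Path.segment a (X.α 0) t - p) =
      Complex.log (p - X.α 0) - Complex.log (p - a) := by
    rw [logVar_sub_comm (f := fun t => Path.segment a (X.α 0) t) (g := fun _ => p)
      (Path.continuous _) continuous_const (fun t e => by have := nl' t; rw [e] at this; simp at this),
      logVar_of_mem_slitPlane (g := fun t => p - Path.segment a (X.α 0) t)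
        (continuous_const.sub (Path.continuous _)) (fun t => Or.inl (nl' t)),
      Path.source, Path.target]
  have e1 : logVar (fun t => (X.extend a b ha hb).α t - p) =
      Complex.log (p - X.α 0) - Complex.log (p - a) + logVar (fun t => X.α t - p) := by
    rw [← e0]
    exact logVar_path_trans (Path.segment a (X.α 0)) X.pathα (p := p)
      (fun t e => by have := nl' t; rw [e] at this; simp at this) h.1
  have e0' : logVar (fun t => Path.segment (X.β 1) b t - p) =
      Complex.log (b - p) - Complex.log (X.β 1 - p) := by
    rw [logVar_of_mem_slitPlane (g := fun t => Path.segment (X.β 1) b t - p)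
        ((Path.continuous _).sub continuous_const) (fun t => Or.inl (nr' t)),
      Path.source, Path.target]
  have e2 : logVar (fun t => (X.extend a b ha hb).β t - p) =
      logVar (fun t => X.β t - p) + (Complex.log (b - p) - Complex.log (X.β 1 - p)) := by
    rw [← e0']
    exact logVar_path_trans X.pathβ (Path.segment (X.β 1) b) (p := p) h.2
      (fun t e => by have := nr' t; rw [e] at this; simp at this)
  rw [halfTurns, halfTurns]
  congr 3
  rw [turn, turn, e1, e2, extend_α_zero, extend_β_one]
  ring

end extend

end Strand

/-! ### The rotation of the difference of two exponentials -/

/-- The entire function `(e ^ w - 1) / w`. -/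
def expQuot (w : ℂ) : ℂ := dslope Complex.exp 0 w

theorem continuous_expQuot : Continuous expQuot := by
  rw [continuous_iff_continuousAt]
  intro w
  have hd : DifferentiableAt ℂ Complex.exp 0 := Complex.differentiableAt_exp
  rcases eq_or_ne w 0 with rfl | hw
  · exact continuousAt_dslope_same.2 hd
  · exact (continuousAt_dslope_of_ne hw).2 Complex.continuous_exp.continuousAt

theorem mul_expQuot (w : ℂ) : w * expQuot w = Complex.exp w - 1 := by
  have := sub_smul_dslope Complex.exp 0 w
  simpa [expQuot] using this

theorem expQuot_zero : expQuot 0 = 1 := by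
  simp [expQuot]

theorem expQuot_ne_zero {w : ℂ} (h : Complex.exp w = 1 → w = 0) : expQuot w ≠ 0 := by
  intro h0
  have := mul_expQuot w
  rw [h0, mul_zero, eq_comm, sub_eq_zero] at this
  rw [h this, expQuot_zero] at h0
  exact one_ne_zero h0

/-- Reduces the half-plane re ≥ 0 to re ≤ 0, where the principal logarithm of `expQuot` is usable.
-/
theorem expQuot_eq_exp_mul (w : ℂ) : expQuot w = Complex.exp w * expQuot (-w) := by
  rcases eq_or_ne w 0 with rfl | hw
  · simp
  · have h1 := mul_expQuot w
    have h2 := mul_expQuot (-w)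
    have h3 : Complex.exp w * Complex.exp (-w) = 1 := by rw [← Complex.exp_add]; simp
    apply mul_left_cancel₀ hw
    linear_combination h1 + Complex.exp w * h2 + h3

theorem re_one_sub_exp_pos {w : ℂ} (hw : w.re ≤ 0) (h : Complex.exp w ≠ 1) :
    0 < (1 - Complex.exp w).re := by
  have h1 : ‖Complex.exp w‖ ≤ 1 := by rw [Complex.norm_exp]; exact Real.exp_le_one_iff.2 hw
  have h2 := Complex.re_le_norm (Complex.exp w)
  rw [Complex.sub_re, Complex.one_re, sub_pos]
  refine lt_of_le_of_ne (h2.trans h1) fun h3 => h ?_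
  have h4 : ‖Complex.exp w‖ = 1 := le_antisymm h1 (h3 ▸ h2)
  have h5 := Complex.sq_norm (Complex.exp w)
  rw [Complex.normSq_apply, h4, h3] at h5
  apply Complex.ext
  · exact h3
  · rw [Complex.one_im]; nlinarith

theorem exp_log_sub_log_eq_expQuot {w : ℂ} (h : Complex.exp w ≠ 1) :
    Complex.exp (Complex.log (1 - Complex.exp w) - Complex.log (-w)) = expQuot w := by
  have hw : w ≠ 0 := fun h' => h (by simp [h'])
  rw [Complex.exp_sub, Complex.exp_log (sub_ne_zero.2 h.symm),
    Complex.exp_log (neg_ne_zero.2 hw)]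
  have := mul_expQuot w
  field_simp
  linear_combination -this

/-- Here 1 - e^w lies in the open right half-plane and -w in the closed one, so their arguments
differ by less than π and no multiple of 2πi appears. -/
theorem log_expQuot {w : ℂ} (hw : w.re ≤ 0) (h : Complex.exp w ≠ 1) :
    expQuot w ∈ Complex.slitPlane ∧
      Complex.log (expQuot w) = Complex.log (1 - Complex.exp w) - Complex.log (-w) := by
  have a1 := abs_lt.1 (Complex.abs_arg_lt_pi_div_two_iff.2 (Or.inl (re_one_sub_exp_pos hw h)))
  have a2 := abs_le.1 (Complex.abs_arg_le_pi_div_two_iff.2 (show 0 ≤ (-w).re by simpa using hw))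
  have h1 : (Complex.log (1 - Complex.exp w) - Complex.log (-w)).im =
      (1 - Complex.exp w).arg - (-w).arg := by simp [Complex.log_im]
  have h2 : Complex.log (expQuot w) = Complex.log (1 - Complex.exp w) - Complex.log (-w) := by
    rw [← exp_log_sub_log_eq_expQuot h, Complex.log_exp] <;> rw [h1] <;> linarith
  refine ⟨?_, h2⟩
  rw [Complex.mem_slitPlane_iff_arg]
  constructor
  · rw [← Complex.log_im, h2, h1]
    intro h3
    linarith
  · rw [← exp_log_sub_log_eq_expQuot h]
    exact Complex.exp_ne_zero _

theorem expQuot_mem_slitPlane {w : ℂ} (hw : w.re ≤ 0) (h : Complex.exp w = 1 → w = 0) :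
    expQuot w ∈ Complex.slitPlane := by
  rcases eq_or_ne w 0 with rfl | h0
  · rw [expQuot_zero]; exact Complex.one_mem_slitPlane
  · exact (log_expQuot hw (fun h' => h0 (h h'))).1

theorem logVar_of_re_nonneg {g : I → ℂ} (hg : Continuous g) (h : ∀ t, 0 ≤ (g t).re)
    (h0 : ∀ t, g t ≠ 0) : logVar g = Complex.log (g 1) - Complex.log (g 0) :=
  logVar_of_mem_slitPlane hg fun t => by
    rcases (h t).lt_or_eq with h1 | h1
    · exact Or.inl h1
    · exact Or.inr fun h2 => h0 t (Complex.ext h1.symm h2)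

theorem logVar_of_re_nonpos {g : I → ℂ} (hg : Continuous g) (h : ∀ t, (g t).re ≤ 0)
    (h0 : ∀ t, g t ≠ 0) : logVar g = Complex.log (-g 1) - Complex.log (-g 0) := by
  rw [← logVar_const_mul (c := -1) (by norm_num) hg h0]
  simpa using logVar_of_re_nonneg (g := fun t => -1 * g t) (by fun_prop)
    (fun t => by simpa using h t) (fun t => by simpa using h0 t)

theorem logVar_expQuot_of_re_nonpos {w : I → ℂ} (hw : Continuous w) (h : ∀ t, (w t).re ≤ 0)
    (h0 : ∀ t, Complex.exp (w t) = 1 → w t = 0) : logVar (fun t => expQuot (w t)) =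
      Complex.log (expQuot (w 1)) - Complex.log (expQuot (w 0)) :=
  logVar_of_mem_slitPlane (continuous_expQuot.comp hw)
    (fun t => expQuot_mem_slitPlane (h t) (h0 t))

theorem logVar_expQuot_of_re_nonneg {w : I → ℂ} (hw : Continuous w) (h : ∀ t, 0 ≤ (w t).re)
    (h0 : ∀ t, Complex.exp (w t) = 1 → w t = 0) : logVar (fun t => expQuot (w t)) =
      w 1 - w 0 + (Complex.log (expQuot (-w 1)) - Complex.log (expQuot (-w 0))) := by
  have h0' : ∀ t, Complex.exp (-w t) = 1 → -w t = 0 := fun t ht => by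
    rw [Complex.exp_neg, inv_eq_one] at ht
    rw [h0 t ht, neg_zero]
  have e : (fun t => expQuot (w t)) = fun t => Complex.exp (w t) * expQuot (-w t) := by
    ext t; exact expQuot_eq_exp_mul _
  rw [e, logVar_mul (f := fun t => Complex.exp (w t)) (g := fun t => expQuot (-w t)) (by fun_prop)
    (fun t => Complex.exp_ne_zero _)
    (continuous_expQuot.comp hw.neg) (fun t => expQuot_ne_zero (h0' t)),
    logVar_eq hw (fun t => rfl),
    logVar_expQuot_of_re_nonpos (w := fun t => -w t) hw.neg (fun t => by simpa using h t) h0']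

theorem log_mul_I_sub_log_neg {x : ℝ} (hx : 0 < x) : Complex.log (x * Complex.I) -
    Complex.log (-(x * Complex.I)) = Real.pi * Complex.I := by
  have h1 : Complex.log (x * Complex.I) = Real.log x + Real.pi / 2 * Complex.I := by
    rw [Complex.log_ofReal_mul hx Complex.I_ne_zero, Complex.log_I]
  have h2 : Complex.log (-(x * Complex.I)) = Real.log x - Real.pi / 2 * Complex.I := by
    rw [← mul_neg, Complex.log_ofReal_mul hx (neg_ne_zero.2 Complex.I_ne_zero), Complex.log_neg_I]
    ring
  rw [h1, h2]; ring

/-- From e^ζ - e^x = e^x (ζ - x) `expQuot` (ζ - x). The linear factor vanishes only at ζ = x, the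
other one only at nontrivial translates of x, so x can be moved along a different path in each
factor. -/
theorem logVar_exp_sub_exp_eq {ζ : I → ℂ} (hζ : Continuous ζ) {x : ℂ}
    (h : ∀ t, Complex.exp x ≠ Complex.exp (ζ t)) :
    logVar (fun t => Complex.exp (ζ t) - Complex.exp x) =
      logVar (fun t => ζ t - x) + logVar (fun t => expQuot (ζ t - x)) := by
  have h1 : ∀ t, ζ t - x ≠ 0 := fun t h' => h t (by rw [sub_eq_zero.1 h'])
  have h2 : ∀ t, expQuot (ζ t - x) ≠ 0 := fun t => expQuot_ne_zero fun h' => by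
    rw [Complex.exp_sub, div_eq_one_iff_eq (Complex.exp_ne_zero _)] at h'
    exact absurd h'.symm (h t)
  have hc : Continuous fun t => expQuot (ζ t - x) :=
    continuous_expQuot.comp (hζ.sub continuous_const)
  rw [← logVar_mul (f := fun t => ζ t - x) (g := fun t => expQuot (ζ t - x)) (by fun_prop) h1 hc h2,
    ← logVar_const_mul (Complex.exp_ne_zero x) (g := fun t => (ζ t - x) * expQuot (ζ t - x))
      (by fun_prop) (fun t => mul_ne_zero (h1 t) (h2 t))]
  congr 1
  ext t
  rw [mul_expQuot, mul_sub, ← Complex.exp_add]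
  simp

theorem logVar_expQuot_square {f g : I → ℂ} (hf : Continuous f) (hg : Continuous g)
    (h : ∀ s t, Complex.exp (f s) = Complex.exp (g t) → f s = g t) :
    logVar (fun t => expQuot (g t - f 0)) + logVar (fun s => expQuot (g 1 - f s)) =
      logVar (fun s => expQuot (g 0 - f s)) + logVar (fun t => expQuot (g t - f 1)) :=
  logVar_square (G := fun x => expQuot (g x.2 - f x.1))
    (continuous_expQuot.comp (by fun_prop)) fun x => expQuot_ne_zero fun h' => by
      rw [Complex.exp_sub, div_eq_one_iff_eq (Complex.exp_ne_zero _)] at h'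
      rw [h x.1 x.2 h'.symm, sub_self]

/-- Two paths in the half-plane `re ≤ c` end at `c` and start at odd multiples of `πi` above and
below `c`. If their first parts are disjoint, and their second parts are disjoint from the
nontrivial translates of each other by multiples of `2πi`, then the image of one path under `exp`
makes minus half a turn around the image of the marked point of the other one. -/
theorem logVar_exp_sub_exp_add {ξα ξβ ζα ζβ : I → ℂ} (cξα : Continuous ξα) (cξβ : Continuous ξβ)
    (cζα : Continuous ζα) (cζβ : Continuous ζβ) (hξ : ξα 1 = ξβ 0) (hζ : ζα 1 = ζβ 0) {c : ℝ}
    (bξα : ∀ t, (ξα t).re ≤ c) (bξβ : ∀ t, (ξβ t).re ≤ c)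
    (bζα : ∀ t, (ζα t).re ≤ c) (bζβ : ∀ t, (ζβ t).re ≤ c) {n m : ℤ} (om : Odd m)
    (hn : n < 0) (hm : 0 < m) (hξ0 : ξα 0 = c + n * (Real.pi * Complex.I))
    (hζ0 : ζα 0 = c + m * (Real.pi * Complex.I)) (hξ1 : ξβ 1 = c) (hζ1 : ζβ 1 = c)
    (hαα : ∀ s t, ξα s ≠ ζα t) (hαβ : ∀ s t, Complex.exp (ξα s) ≠ Complex.exp (ζβ t))
    (hβα : ∀ s t, Complex.exp (ξβ s) ≠ Complex.exp (ζα t))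
    (hββ : ∀ s t, Complex.exp (ξβ s) = Complex.exp (ζβ t) → ξβ s = ζβ t) :
    logVar (fun t => Complex.exp (ζα t) - Complex.exp (ξα 1)) +
      logVar (fun t => Complex.exp (ζβ t) - Complex.exp (ξα 1)) =
      Complex.log (Complex.exp c - Complex.exp (ξα 1)) -
        Complex.log (Complex.exp c + Complex.exp (ξα 1)) - Real.pi * Complex.I := by
  have hαβ' : ∀ s t, ξα s ≠ ζβ t := fun s t h => hαβ s t (by rw [h])
  have cre : ∀ k : ℤ, ((c : ℂ) + k * (Real.pi * Complex.I)).re = c := fun k => by simp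
  have rξ0 : (ξα 0).re = c := by rw [hξ0, cre]
  have rζ0 : (ζα 0).re = c := by rw [hζ0, cre]
  -- In the linear factor the viewpoint is moved back along ξα to its start; in the other factor it
  -- is moved forward along ξβ to c, where meetings of ξβ with ζβ do no harm. All remaining
  -- differences involve a point of the line re = c, so their real parts have a constant sign.
  rw [logVar_exp_sub_exp_eq cζα (fun t => by rw [hξ]; exact hβα 0 t),
    logVar_exp_sub_exp_eq cζβ (fun t => hαβ 1 t)]
  -- the linear factor
  have S1 := logVar_sub_square cξα cζα hαα
  have S2 := logVar_sub_square cξα cζβ hαβ'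
  have A1 := logVar_of_re_nonpos (g := fun t => ζα t - ξα 0) (by fun_prop)
    (fun t => by rw [Complex.sub_re, rξ0]; linarith [bζα t])
    (fun t => sub_ne_zero.2 (hαα 0 t).symm)
  have A2 := logVar_of_re_nonpos (g := fun t => ζβ t - ξα 0) (by fun_prop)
    (fun t => by rw [Complex.sub_re, rξ0]; linarith [bζβ t])
    (fun t => sub_ne_zero.2 (hαβ' 0 t).symm)
  have A3 := logVar_of_re_nonpos (g := fun t => ξα t - ζβ 1) (by fun_prop)
    (fun t => by rw [Complex.sub_re, hζ1, Complex.ofReal_re]; linarith [bξα t])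
    (fun t => sub_ne_zero.2 (hαβ' t 1))
  have A4 := logVar_of_re_nonpos (g := fun t => ξα t - ζα 0) (by fun_prop)
    (fun t => by rw [Complex.sub_re, rζ0]; linarith [bξα t])
    (fun t => sub_ne_zero.2 (hαα t 0))
  simp only [neg_sub] at A1 A2 A3 A4
  -- the other factor
  have hβα' : ∀ s t, Complex.exp (ξβ s) = Complex.exp (ζα t) → ξβ s = ζα t :=
    fun s t h => absurd h (hβα s t)
  have hw : ∀ {a b : ℂ}, (Complex.exp a = Complex.exp b → a = b) →
      Complex.exp (b - a) = 1 → b - a = 0 := fun {a b} h h' => by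
    rw [Complex.exp_sub, div_eq_one_iff_eq (Complex.exp_ne_zero _)] at h'
    rw [h h'.symm, sub_self]
  have T1 := logVar_expQuot_square cξβ cζα hβα'
  have T2 := logVar_expQuot_square cξβ cζβ hββ
  have B1 := logVar_expQuot_of_re_nonpos (w := fun t => ζα t - ξβ 1) (by fun_prop)
    (fun t => by rw [Complex.sub_re, hξ1, Complex.ofReal_re]; linarith [bζα t])
    (fun t => hw (hβα' 1 t))
  have B2 := logVar_expQuot_of_re_nonpos (w := fun t => ζβ t - ξβ 1) (by fun_prop)
    (fun t => by rw [Complex.sub_re, hξ1, Complex.ofReal_re]; linarith [bζβ t])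
    (fun t => hw (hββ 1 t))
  have B3 := logVar_expQuot_of_re_nonneg (w := fun t => ζβ 1 - ξβ t) (by fun_prop)
    (fun t => by rw [Complex.sub_re, hζ1, Complex.ofReal_re]; linarith [bξβ t])
    (fun t => hw (hββ t 1))
  have B4 := logVar_expQuot_of_re_nonneg (w := fun t => ζα 0 - ξβ t) (by fun_prop)
    (fun t => by rw [Complex.sub_re, rζ0]; linarith [bξβ t])
    (fun t => hw (hβα' t 0))
  simp only [neg_sub] at B3 B4
  -- the values at the ends
  have epi : ∀ {k : ℤ}, Odd k → Complex.exp (k * (Real.pi * Complex.I)) = -1 := fun {k} hk => by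
    obtain ⟨l, rfl⟩ := hk
    rw [show ((2 * l + 1 : ℤ) : ℂ) * (Real.pi * Complex.I) =
      l * (2 * Real.pi * Complex.I) + Real.pi * Complex.I by push_cast; ring, Complex.exp_add,
      Complex.exp_int_mul_two_pi_mul_I, Complex.exp_pi_mul_I, one_mul]
  -- As m, -n and m - n are positive, L1, L2, L3 contribute -πi, -πi and πi. Their sum is the single
  -- half-turn of the result, whatever the sizes of n and m.
  have L1 : Complex.log (expQuot (ξβ 1 - ζα 0)) - Complex.log (expQuot (ζα 0 - ξβ 1)) =
      -(Real.pi * Complex.I) := by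
    have e1 : ζα 0 - ξβ 1 = m * (Real.pi * Complex.I) := by rw [hζ0, hξ1]; ring
    have e2 : ξβ 1 - ζα 0 = (-m : ℤ) * (Real.pi * Complex.I) := by
      rw [hζ0, hξ1]; push_cast; ring
    have e3 := log_mul_I_sub_log_neg (x := m * Real.pi) (by positivity)
    rw [e1, e2, (log_expQuot (by simp) (by rw [epi om.neg]; norm_num)).2,
      (log_expQuot (by simp) (by rw [epi om]; norm_num)).2, epi om, epi om.neg]
    push_cast at e3 ⊢
    rw [neg_mul, neg_neg, ← mul_assoc]
    linear_combination -e3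
  have L2 : Complex.log (ξα 0 - ζβ 1) - Complex.log (ζβ 1 - ξα 0) = -(Real.pi * Complex.I) := by
    have e3 := log_mul_I_sub_log_neg (x := (-n : ℤ) * Real.pi)
      (mul_pos (by exact_mod_cast neg_pos.2 hn) Real.pi_pos)
    have e1 : ζβ 1 - ξα 0 = (((-n : ℤ) * Real.pi : ℝ) : ℂ) * Complex.I := by
      rw [hξ0, hζ1]; push_cast; ring
    rw [← neg_sub (ζβ 1), e1]
    linear_combination -e3
  have L3 : Complex.log (ζα 0 - ξα 0) - Complex.log (ξα 0 - ζα 0) = Real.pi * Complex.I := by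
    have e3 := log_mul_I_sub_log_neg (x := (m - n : ℤ) * Real.pi)
      (mul_pos (by exact_mod_cast (by omega : 0 < m - n)) Real.pi_pos)
    have e1 : ζα 0 - ξα 0 = (((m - n : ℤ) * Real.pi : ℝ) : ℂ) * Complex.I := by
      rw [hξ0, hζ0]; push_cast; ring
    rw [← neg_sub (ζα 0), e1]
    linear_combination e3
  have hT : (0 : ℝ) < Real.exp c := Real.exp_pos c
  have q1 : Complex.exp (ξβ 0 - ζα 0) = -(Complex.exp (ξα 1) / Complex.exp c) := by
    rw [hζ0, ← hξ, Complex.exp_sub, Complex.exp_add, epi om, mul_neg_one, div_neg]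
  have q2 : Complex.exp (ξβ 0 - ζβ 1) = Complex.exp (ξα 1) / Complex.exp c := by
    rw [hζ1, ← hξ, Complex.exp_sub]
  have n1 : Complex.exp (ξβ 0 - ζα 0) ≠ 1 := fun h => by
    rw [Complex.exp_sub, div_eq_one_iff_eq (Complex.exp_ne_zero _)] at h
    exact hβα 0 0 h
  have n2 : Complex.exp (ξβ 0 - ζβ 1) ≠ 1 := fun h => by
    rw [← hξ, Complex.exp_sub, div_eq_one_iff_eq (Complex.exp_ne_zero _)] at h
    exact hαβ 1 1 h
  have L4 := (log_expQuot (w := ξβ 0 - ζα 0)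
    (by rw [Complex.sub_re, rζ0]; linarith [bξβ 0]) n1).2
  have L5 := (log_expQuot (w := ξβ 0 - ζβ 1)
    (by rw [Complex.sub_re, hζ1, Complex.ofReal_re]; linarith [bξβ 0]) n2).2
  have hne := Complex.exp_ne_zero c
  have hsc : ∀ {z : ℂ}, z ≠ 0 → Complex.log (Complex.exp c * z) = c + Complex.log z :=
    fun {z} hz => by
      rw [← Complex.ofReal_exp, Complex.log_ofReal_mul hT hz, Real.log_exp]
  have L6 : Complex.log (Complex.exp c + Complex.exp (ξα 1)) =
      c + Complex.log (1 - Complex.exp (ξβ 0 - ζα 0)) := by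
    rw [← hsc (sub_ne_zero.2 n1.symm), q1]
    congr 1
    field_simp
    ring
  have L7 : Complex.log (Complex.exp c - Complex.exp (ξα 1)) =
      c + Complex.log (1 - Complex.exp (ξβ 0 - ζβ 1)) := by
    rw [← hsc (sub_ne_zero.2 n2.symm), q2]
    congr 1
    field_simp
  rw [neg_sub] at L4 L5
  rw [L6, L7]
  rw [← hζ] at A2 S2 B2 T2
  rw [hξ] at *
  have z0 : ζβ 1 - ξβ 1 = 0 := by rw [hζ1, hξ1, sub_self]
  have z1 : ξβ 1 - ζβ 1 = 0 := by rw [hζ1, hξ1, sub_self]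
  rw [z0, expQuot_zero, Complex.log_one] at B2
  rw [z1, expQuot_zero, Complex.log_one] at B3
  linear_combination -S1 - S2 - A4 + A1 + A2 + A3 + T1 + T2 + B4 + B1 + B2 - B3 + L1 + L2 + L3 - L4 + L5 

/-! ### Transitivity of the position of strands -/

namespace Strand

variable {R : ℝ}

/-- The branch of `log (y - p)` off the second part of a strand with the marked point `y`. -/
def logα (Y : Strand R) (p : ℂ) : ℂ :=
  Complex.log (Y.β 1 - p) - logVar (fun t => Y.β t - p)

/-- The branch of `log (p - y)` off the first part of a strand with the marked point `y`. -/
def logβ (Y : Strand R) (p : ℂ) : ℂ :=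
  Complex.log (p - Y.α 0) + logVar (fun t => Y.α t - p)

/-- At the marked point of another strand this glues the logarithms of its two parts: the first part
uses `logα` shifted by the turn, the second uses `logβ`. -/
theorem logβ_eq (Y : Strand R) (p : ℂ) : Y.logβ p = Y.logα p + Y.turn p := by
  rw [logα, logβ, turn]; ring

theorem exp_logα (Y : Strand R) {p : ℂ} (h : ∀ t, Y.β t ≠ p) :
    Complex.exp (Y.logα p) = Y.vert - p := by
  have h1 : Y.β 1 - p ≠ 0 := sub_ne_zero.2 (h 1)
  have h2 : Y.β 0 - p ≠ 0 := sub_ne_zero.2 (h 0)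
  rw [logα, Complex.exp_sub, Complex.exp_log h1,
    exp_logVar (g := fun t => Y.β t - p) (Y.continuous_β.sub continuous_const)
      (fun t => sub_ne_zero.2 (h t)), vert_eq]
  field_simp

theorem exp_logβ (Y : Strand R) {p : ℂ} (h : ∀ t, Y.α t ≠ p) :
    Complex.exp (Y.logβ p) = p - Y.vert := by
  have h1 : p - Y.α 0 ≠ 0 := sub_ne_zero.2 (h 0).symm
  have h2 : Y.α 0 - p ≠ 0 := sub_ne_zero.2 (h 0)
  rw [logβ, Complex.exp_add, Complex.exp_log h1,
    exp_logVar (g := fun t => Y.α t - p) (Y.continuous_α.sub continuous_const)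
      (fun t => sub_ne_zero.2 (h t)), vert]
  field_simp
  ring

theorem continuous_logα (Y : Strand R) {g : I → ℂ} (hg : Continuous g)
    (hr : ∀ t, (g t).re < R) (h : ∀ s t, g s ≠ Y.β t) : Continuous fun s => Y.logα (g s) := by
  refine Continuous.sub (Continuous.clog (by fun_prop)
    (fun t => Or.inl (by simp; linarith [hr t, Y.right]))) ?_
  have := Y.continuous_β
  exact continuous_logVar (G := fun x => Y.β x.2 - g x.1) (by fun_prop)
    (fun x => sub_ne_zero.2 (h _ _).symm)

theorem continuous_logβ (Y : Strand R) {g : I → ℂ} (hg : Continuous g)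
    (hl : ∀ t, -R < (g t).re) (h : ∀ s t, Y.α s ≠ g t) : Continuous fun s => Y.logβ (g s) := by
  refine Continuous.add (Continuous.clog (by fun_prop)
    (fun t => Or.inl (by simp; linarith [hl t, Y.left]))) ?_
  have := Y.continuous_α
  exact continuous_logVar (G := fun x => Y.α x.2 - g x.1) (by fun_prop)
    (fun x => sub_ne_zero.2 (h _ _))

theorem logα_of_re_le (Y : Strand R) {p : ℂ} (hp : p.re ≤ -R) :
    Y.logα p = Complex.log (Y.vert - p) := by
  rw [logα, logVar_of_mem_slitPlane (g := fun t => Y.β t - p)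
    (Y.continuous_β.sub continuous_const)
    (fun t => Or.inl (by simp; linarith [Y.lt_re_β t])), vert_eq]
  ring

theorem logβ_of_le_re (Y : Strand R) {p : ℂ} (hp : R ≤ p.re) :
    Y.logβ p = Complex.log (p - Y.vert) := by
  rw [logβ, logVar_sub_comm Y.continuous_α continuous_const
      (fun t e => by have := Y.re_α_lt t; rw [e] at this; linarith),
    logVar_of_mem_slitPlane (g := fun t => p - Y.α t)
    (continuous_const.sub Y.continuous_α)
    (fun t => Or.inl (by simp; linarith [Y.re_α_lt t])), vert]
  ring

/-- The logarithm of p - y is continued along X and Z, where y is the marked point of Y. Both lifts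
end at c; they start at c plus a negative, respectively a positive, odd multiple of πi, as in
`logVar_exp_sub_exp_add`. -/
theorem halfTurns_trans_of_ends {X Y Z : Strand R} (hXY : X.Compat Y) (hZY : Z.Compat Y)
    (hXZ : X.Compat Z) (h1 : Y.halfTurns X.vert < 0) (h2 : 0 < Y.halfTurns Z.vert) {c : ℝ}
    (X0 : X.α 0 = Y.vert - Complex.exp c) (X1 : X.β 1 = Y.vert + Complex.exp c)
    (Z0 : Z.α 0 = Y.vert - Complex.exp c) (Z1 : Z.β 1 = Y.vert + Complex.exp c)
    (bXα : ∀ t, ‖X.α t - Y.vert‖ ≤ Real.exp c) (bXβ : ∀ t, ‖X.β t - Y.vert‖ ≤ Real.exp c)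
    (bZα : ∀ t, ‖Z.α t - Y.vert‖ ≤ Real.exp c) (bZβ : ∀ t, ‖Z.β t - Y.vert‖ ≤ Real.exp c) :
    Z.halfTurns X.vert = -1 := by
  have logc : Complex.log (Complex.exp c) = c := by
    rw [← Complex.ofReal_exp, ← Complex.ofReal_log (Real.exp_pos c).le, Real.log_exp]
  have turn_odd : ∀ {W : Strand R}, W.Compat Y →
      Complex.exp (Y.turn W.vert) = -1 := fun {W} hW => by
    obtain ⟨n, hn⟩ := Y.exists_turn_eq hW.symm.avoids
    rw [hn, show ((2 * n + 1 : ℤ) : ℂ) * (Real.pi * Complex.I) =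
      n * (2 * Real.pi * Complex.I) + Real.pi * Complex.I by push_cast; ring, Complex.exp_add,
      Complex.exp_int_mul_two_pi_mul_I, Complex.exp_pi_mul_I, one_mul]
  have expα : ∀ {W : Strand R}, W.Compat Y → ∀ t,
      Complex.exp (Y.logα (W.α t) + Y.turn W.vert) = W.α t - Y.vert := fun {W} hW t => by
    rw [Complex.exp_add, turn_odd hW, Y.exp_logα (fun s => (hW.1 t s).symm)]
    ring
  have expβ : ∀ {W : Strand R}, W.Compat Y → ∀ t,
      Complex.exp (Y.logβ (W.β t)) = W.β t - Y.vert := fun {W} hW t =>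
    Y.exp_logβ (fun s => hW.2 s t)
  have bound : ∀ {w p : ℂ}, Complex.exp w = p - Y.vert → ‖p - Y.vert‖ ≤ Real.exp c → w.re ≤ c :=
    fun {w p} h hb => by
      rw [← h, Complex.norm_exp] at hb
      exact Real.exp_le_exp.1 hb
  have cα : ∀ {W : Strand R}, W.Compat Y →
      Continuous fun t => Y.logα (W.α t) + Y.turn W.vert := fun {W} hW =>
    (Y.continuous_logα W.continuous_α W.re_α_lt hW.1).add continuous_const
  have cβ : ∀ {W : Strand R}, W.Compat Y → Continuous fun t => Y.logβ (W.β t) := fun {W} hW =>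
    Y.continuous_logβ W.continuous_β W.lt_re_β hW.2
  have hj : ∀ {W : Strand R}, Y.logα (W.α 1) + Y.turn W.vert = Y.logβ (W.β 0) := fun {W} => by
    rw [logβ_eq, ← W.join]; rfl
  have start : ∀ {W : Strand R}, W.Compat Y → W.α 0 = Y.vert - Complex.exp c →
      Y.logα (W.α 0) + Y.turn W.vert =
        c + Y.halfTurns W.vert * (Real.pi * Complex.I) := fun {W} hW hW0 => by
    rw [Y.logα_of_re_le W.left, (Y.turn_eq hW.symm.avoids).1, hW0, sub_sub_cancel, logc]
  have finish : ∀ {W : Strand R}, W.β 1 = Y.vert + Complex.exp c → Y.logβ (W.β 1) = c :=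
    fun {W} hW1 => by
      rw [Y.logβ_of_le_re W.right, hW1, add_sub_cancel_left, logc]
  have key := logVar_exp_sub_exp_add (cα hXY) (cβ hXY) (cα hZY) (cβ hZY) hj hj
    (fun t => bound (expα hXY t) (bXα t)) (fun t => bound (expβ hXY t) (bXβ t))
    (fun t => bound (expα hZY t) (bZα t)) (fun t => bound (expβ hZY t) (bZβ t))
    (Y.turn_eq hZY.symm.avoids).2 h1 h2 (start hXY X0) (start hZY Z0) (finish X1) (finish Z1)
    -- The first parts of X and Z may cross, but their lifts do not: the same branch is shifted by
    -- two different turns.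
    (fun s t h => by
      have e : X.α s = Z.α t := by
        have := congrArg Complex.exp h
        rw [expα hXY, expα hZY] at this
        exact sub_left_injective this
      rw [e, add_right_inj, (Y.turn_eq hXY.symm.avoids).1, (Y.turn_eq hZY.symm.avoids).1] at h
      have hpi : (Real.pi * Complex.I : ℂ) ≠ 0 := by simp [Real.pi_ne_zero]
      have := Int.cast_injective (mul_right_cancel₀ hpi h)
      omega)
    (fun s t h => by
      rw [expα hXY, expβ hZY] at h
      exact hXZ.1 s t (sub_left_injective h))
    (fun s t h => by
      rw [expβ hXY, expα hZY] at h
      exact hXZ.2 t s (sub_left_injective h).symm)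
    -- The lifts of the second parts use one branch without shifts, so equal points have equal
    -- lifts.
    (fun s t h => by
      rw [expβ hXY, expβ hZY] at h
      rw [sub_left_injective h])
  simp only [expα hXY, expα hZY, expβ hZY, sub_sub_sub_cancel_right] at key
  apply halfTurns_of_turn_eq
  have e1 : Complex.exp c - (X.α 1 - Y.vert) = Z.β 1 - X.vert := by rw [Z1, vert, vert]; ring
  have e2 : Complex.exp c + (X.α 1 - Y.vert) = X.vert - Z.α 0 := by rw [Z0, vert, vert]; ring
  rw [e1, e2] at key
  rw [turn]
  push_cast
  rw [vert] at key ⊢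
  linear_combination key

theorem exists_norm_sub_le {g : I → ℂ} (hg : Continuous g) (p : ℂ) :
    ∃ C : ℝ, ∀ t, ‖g t - p‖ ≤ C := by
  obtain ⟨C, hC⟩ := isCompact_univ.exists_bound_of_continuousOn
    (f := fun t => g t - p) (by fun_prop : Continuous fun t => g t - p).continuousOn
  exact ⟨C, fun t => hC t trivial⟩

/-- If one strand passes above the marked point of a second one, and the second one passes above
the marked point of a third one, then the first one passes above the marked point of the third. -/
theorem halfTurns_trans {X Y Z : Strand R} (hXY : X.Compat Y) (hZY : Z.Compat Y)
    (hXZ : X.Compat Z) (h1 : Y.halfTurns X.vert < 0) (h2 : 0 < Y.halfTurns Z.vert) :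
    Z.halfTurns X.vert = -1 := by
  obtain ⟨C₁, hC₁⟩ := exists_norm_sub_le X.continuous_α Y.vert
  obtain ⟨C₂, hC₂⟩ := exists_norm_sub_le X.continuous_β Y.vert
  obtain ⟨C₃, hC₃⟩ := exists_norm_sub_le Z.continuous_α Y.vert
  obtain ⟨C₄, hC₄⟩ := exists_norm_sub_le Z.continuous_β Y.vert
  -- The disc of radius e^c about y contains X and Z, and 2R ≤ e^c places y ± e^c outside the strip,
  -- so all strands can be extended to these common ends.
  obtain ⟨c, hc⟩ : ∃ c : ℝ, max (max C₁ C₂) (max C₃ C₄) ≤ Real.exp c ∧ 2 * R ≤ Real.exp c := by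
    refine ⟨max (max (max C₁ C₂) (max C₃ C₄)) (2 * R), ?_⟩
    rw [← max_le_iff]
    linarith [Real.add_one_le_exp (max (max (max C₁ C₂) (max C₃ C₄)) (2 * R))]
  simp only [max_le_iff] at hc
  obtain ⟨⟨⟨c1, c2⟩, c3, c4⟩, cR⟩ := hc
  have ha : (Y.vert - Complex.exp c).re ≤ -R := by
    rw [← Complex.ofReal_exp, Complex.sub_re, Complex.ofReal_re]; linarith [Y.vert_re_lt]
  have hb : R ≤ (Y.vert + Complex.exp c).re := by
    rw [← Complex.ofReal_exp, Complex.add_re, Complex.ofReal_re]; linarith [Y.lt_vert_re]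
  have nexp : ‖Complex.exp (c : ℂ)‖ = Real.exp c := by rw [Complex.norm_exp, Complex.ofReal_re]
  have ball : ∀ {p q r : ℂ}, ‖p - Y.vert‖ ≤ Real.exp c → ‖q - Y.vert‖ ≤ Real.exp c →
      r ∈ segment ℝ p q → ‖r - Y.vert‖ ≤ Real.exp c := fun {p q r} hp hq hr => by
    rw [← dist_eq_norm] at hp hq ⊢
    exact (convex_closedBall Y.vert (Real.exp c)).segment_subset hp hq hr
  have boundα : ∀ {W : Strand R}, (∀ t, ‖W.α t - Y.vert‖ ≤ Real.exp c) →
      ∀ t, ‖(W.extend _ _ ha hb).α t - Y.vert‖ ≤ Real.exp c := fun {W} hW t => by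
    rcases W.extend_α_cases _ _ ha hb t with h | ⟨s, hs⟩
    · exact ball (by rw [sub_sub_cancel_left, norm_neg, nexp]) (hW 0) h
    · rw [hs]; exact hW s
  have boundβ : ∀ {W : Strand R}, (∀ t, ‖W.β t - Y.vert‖ ≤ Real.exp c) →
      ∀ t, ‖(W.extend _ _ ha hb).β t - Y.vert‖ ≤ Real.exp c := fun {W} hW t => by
    rcases W.extend_β_cases _ _ ha hb t with h | ⟨s, hs⟩
    · exact ball (hW 1) (by rw [add_sub_cancel_left, nexp]) h
    · rw [hs]; exact hW s
  have key := halfTurns_trans_of_ends (X := X.extend _ _ ha hb) (Y := Y.extend _ _ ha hb)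
    (Z := Z.extend _ _ ha hb) (c := c) (hXY.extend _ _ ha hb ha hb) (hZY.extend _ _ ha hb ha hb)
    (hXZ.extend _ _ ha hb ha hb)
    (by rwa [extend_vert, halfTurns_extend _ _ _ _ X.lt_vert_re X.vert_re_lt hXY.symm.avoids])
    (by rwa [extend_vert, halfTurns_extend _ _ _ _ Z.lt_vert_re Z.vert_re_lt hZY.symm.avoids])
    (by rw [extend_α_zero, extend_vert]) (by rw [extend_β_one, extend_vert])
    (by rw [extend_α_zero, extend_vert]) (by rw [extend_β_one, extend_vert])
    (by rw [extend_vert]; exact boundα fun t => (hC₁ t).trans c1)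
    (by rw [extend_vert]; exact boundβ fun t => (hC₂ t).trans c2)
    (by rw [extend_vert]; exact boundα fun t => (hC₃ t).trans c3)
    (by rw [extend_vert]; exact boundβ fun t => (hC₄ t).trans c4)
  rwa [extend_vert, halfTurns_extend _ _ _ _ X.lt_vert_re X.vert_re_lt hXZ.symm.avoids] at key

end Strand

/-! ### Three strands and a triangle -/

/-- Repeated doubling of a k with the wrong sign of A k would contradict the signs far out, so A is
positive for k < 0 and negative for k > 0. If d = 2c, the reflection makes A (-c) its own negative,
impossible for an odd number. If d = 2c + 1, the signs at -c - 1 and -c are opposite, so one of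
these two numbers is 0. -/
theorem Int.eq_one_or_neg_one_of_odd_reflection {A : ℤ → ℤ} {d : ℤ} (hodd : ∀ k, Odd (A k))
    (hrefl : ∀ k, A (-k) = -A (k - d)) (hneg : ∀ k, A k < 0 → A (2 * k) < 0)
    (hpos : ∀ k, 0 < A k → 0 < A (2 * k)) {K : ℤ} (hlow : ∀ k ≤ -K, 0 < A k)
    (hhigh : ∀ k, K ≤ k → A k < 0) : d = 1 ∨ d = -1 := by
  have h1 : ∀ k, A k < 0 → 0 ≤ k := by
    intro k hk
    by_contra! hk0
    have hj : ∀ j : ℕ, A (2 ^ j * k) < 0 := fun j => by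
      induction j with
      | zero => simpa using hk
      | succ j ih => rw [pow_succ', mul_assoc]; exact hneg _ ih
    have hlt : (K.toNat : ℤ) < 2 ^ K.toNat := by exact_mod_cast Nat.lt_two_pow_self
    have hK : K ≤ K.toNat := Int.self_le_toNat K
    have := hlow (2 ^ K.toNat * k) (by nlinarith)
    linarith [hj K.toNat]
  have h2 : ∀ k, 0 < A k → k ≤ 0 := by
    intro k hk
    by_contra! hk0
    have hj : ∀ j : ℕ, 0 < A (2 ^ j * k) := fun j => by
      induction j with
      | zero => simpa using hk
      | succ j ih => rw [pow_succ', mul_assoc]; exact hpos _ ih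
    have hlt : (K.toNat : ℤ) < 2 ^ K.toNat := by exact_mod_cast Nat.lt_two_pow_self
    have hK : K ≤ K.toNat := Int.self_le_toNat K
    have := hhigh (2 ^ K.toNat * k) (by nlinarith)
    linarith [hj K.toNat]
  rcases Int.even_or_odd' d with ⟨c, hc | hc⟩
  · have e := hrefl c
    rw [show c - d = -c by omega] at e
    obtain ⟨l, hl⟩ := hodd (-c)
    omega
  · have e := hrefl c
    rw [show c - d = -c - 1 by omega] at e
    obtain ⟨l, hl⟩ := hodd (-c)
    rcases lt_trichotomy (A (-c)) 0 with h | h | h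
    · have := h1 _ h
      have := h2 (-c - 1) (by omega)
      omega
    · omega
    · have := h2 _ h
      have := h1 (-c - 1) (by omega)
      omega

namespace Strand

variable {R : ℝ}

theorem Compat.shift {X Y : Strand R} (h : X.Compat Y) (k : ℤ) :
    (X.shift k).Compat (Y.shift k) :=
  ⟨fun s t e => h.1 s t (add_right_cancel e), fun s t e => h.2 s t (add_right_cancel e)⟩

/-- All translates of the strands are compatible. -/
def PeriodicCompat (X Y : Strand R) : Prop := ∀ k, X.Compat (Y.shift k)

theorem PeriodicCompat.shift_shift {X Y : Strand R} (h : X.PeriodicCompat Y) (j k : ℤ) :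
    (X.shift j).Compat (Y.shift k) := by
  have := (h (k - j)).shift j
  rwa [Strand.shift_shift, sub_add_cancel] at this

theorem PeriodicCompat.symm {X Y : Strand R} (h : X.PeriodicCompat Y) : Y.PeriodicCompat X :=
  fun k => by
    have := (h.shift_shift k 0).symm
    rwa [shift_zero] at this

theorem halfTurns_shift_vert (X Y : Strand R) (j k : ℤ) :
    (X.shift j).halfTurns (Y.shift k).vert = (X.shift (j - k)).halfTurns Y.vert := by
  rw [shift_vert, ← halfTurns_shift (X.shift (j - k)) k, shift_shift, sub_add_cancel]

theorem halfTurns_shift_antisymm {X Y : Strand R} (h : X.PeriodicCompat Y) (k : ℤ) :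
    (X.shift k).halfTurns Y.vert = -(Y.shift (-k)).halfTurns X.vert := by
  have h1 := halfTurns_antisymm (h.shift_shift k 0)
  rwa [halfTurns_shift_vert, halfTurns_shift_vert, sub_zero, zero_sub] at h1

/-- A strand is bounded, so a large shift puts it wholly below or above p. -/
theorem exists_halfTurns_shift (Y : Strand R) {p : ℂ} (hl : -R < p.re) (hr : p.re < R) :
    ∃ K : ℤ, (∀ k ≤ -K, (Y.shift k).halfTurns p = 1) ∧
      ∀ k, K ≤ k → (Y.shift k).halfTurns p = -1 := by
  obtain ⟨C₁, h₁⟩ := exists_norm_sub_le Y.continuous_α p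
  obtain ⟨C₂, h₂⟩ := exists_norm_sub_le Y.continuous_β p
  obtain ⟨K, hK⟩ := exists_nat_gt (max C₁ C₂)
  rw [max_lt_iff] at hK
  have im : ∀ (z : ℂ) (k : ℤ), (z + k * (2 * Real.pi * Complex.I)).im = z.im + k * (2 * Real.pi) :=
    fun z k => by simp
  have b₁ : ∀ t, |(Y.α t).im - p.im| < K := fun t => by
    rw [← Complex.sub_im]
    exact ((Complex.abs_im_le_norm _).trans (h₁ t)).trans_lt hK.1
  have b₂ : ∀ t, |(Y.β t).im - p.im| < K := fun t => by
    rw [← Complex.sub_im]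
    exact ((Complex.abs_im_le_norm _).trans (h₂ t)).trans_lt hK.2
  simp only [abs_lt] at b₁ b₂
  have K0 : (0 : ℝ) ≤ K := K.cast_nonneg
  have hpi := Real.pi_gt_three
  refine ⟨K, fun k hk => ?_, fun k hk => ?_⟩
  · have hk' : (k : ℝ) ≤ -K := by exact_mod_cast hk
    apply halfTurns_of_im_lt _ hl hr <;> intro t
    · rw [Strand.shift, im]; nlinarith [b₁ t]
    · rw [Strand.shift, im]; nlinarith [b₂ t]
  · have hk' : (K : ℝ) ≤ k := by exact_mod_cast hk
    apply halfTurns_of_lt_im _ hl hr <;> intro t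
    · rw [Strand.shift, im]; nlinarith [b₁ t]
    · rw [Strand.shift, im]; nlinarith [b₂ t]

/-- A path joining `p` to `q` in the strip `|re| < R` off all translates of a strand. -/
def JoinedOff (X : Strand R) (p q : ℂ) : Prop :=
  ∃ γ : I → ℂ, Continuous γ ∧ γ 0 = p ∧ γ 1 = q ∧ (∀ t, -R < (γ t).re) ∧ (∀ t, (γ t).re < R) ∧
    ∀ k t, (X.shift k).Avoids (γ t)

theorem JoinedOff.halfTurns_eq {X : Strand R} {p q : ℂ} (h : X.JoinedOff p q) (k : ℤ) :
    (X.shift k).halfTurns p = (X.shift k).halfTurns q := by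
  obtain ⟨γ, hγ, rfl, rfl, hl, hr, h⟩ := h
  exact (X.shift k).halfTurns_eq_of_path hγ hl hr (h k)

/-- A triangle through the marked points of three periodically compatible strands, each side of
which is disjoint from the opposite strand, closes up with the shift by one period. -/
theorem period_eq_one_or_neg_one {X Y Z : Strand R} (hXY : X.PeriodicCompat Y)
    (hYZ : Y.PeriodicCompat Z) (hZX : Z.PeriodicCompat X) {d : ℤ}
    (hX : X.JoinedOff Y.vert Z.vert) (hZ : Z.JoinedOff X.vert Y.vert)
    (hY : Y.JoinedOff Z.vert (X.shift d).vert) : d = 1 ∨ d = -1 := by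
  -- All relative positions are expressed through Y seen from X; e3 and e4 compute Y seen from Z in
  -- two ways, which yields the reflection.
  have e1 : ∀ k, -(Y.shift (-k)).halfTurns X.vert = (X.shift k).halfTurns Z.vert := fun k => by
    rw [← hX.halfTurns_eq, halfTurns_shift_antisymm hXY]
  have e2 : ∀ k, (Z.shift k).halfTurns X.vert = (Y.shift k).halfTurns X.vert := fun k => by
    rw [halfTurns_shift_antisymm hZX, ← e1, neg_neg, neg_neg]
  have e3 : ∀ k, (Y.shift k).halfTurns Z.vert = -(Y.shift (-k)).halfTurns X.vert := fun k => by
    rw [halfTurns_shift_antisymm hYZ, ← hZ.halfTurns_eq, e2]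
  have e4 : ∀ k, (Y.shift k).halfTurns Z.vert = (Y.shift (k - d)).halfTurns X.vert := fun k => by
    rw [hY.halfTurns_eq, halfTurns_shift_vert]
  obtain ⟨K, hlow, hhigh⟩ := Y.exists_halfTurns_shift X.lt_vert_re X.vert_re_lt
  -- By antisymmetry, Z shifted by 2k lies relative to Y shifted by k as the latter lies relative to
  -- X; transitivity through the middle strand then doubles k.
  have e5 : ∀ k, (Y.shift k).halfTurns (Z.shift (2 * k)).vert =
      -(Y.shift k).halfTurns X.vert := fun k => by
    rw [halfTurns_shift_vert, e3]
    congr 4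
    ring
  refine Int.eq_one_or_neg_one_of_odd_reflection (A := fun k => (Y.shift k).halfTurns X.vert)
    (K := K) (fun k => (turn_eq _ (hXY k).symm.avoids).2) (fun k => ?_) (fun k hk => ?_)
    (fun k hk => ?_) (fun k hk => by simp [hlow k hk]) (fun k hk => by simp [hhigh k hk])
  · show _ = _
    rw [← e4, e3, neg_neg]
  · have := halfTurns_trans (hXY k) (hYZ.symm.shift_shift (2 * k) k) (hZX.symm (2 * k)) hk
      (by rw [e5]; exact neg_pos.2 hk)
    rw [e2] at this
    simp [this]
  · have := halfTurns_trans (hYZ.symm.shift_shift (2 * k) k) (hXY k) (hZX.symm (2 * k)).symm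
      (by rw [e5]; exact neg_neg_iff_pos.2 hk) hk
    rw [halfTurns_antisymm (hZX.symm (2 * k)), e2] at this
    show 0 < (Y.shift (2 * k)).halfTurns X.vert
    omega

end Strand

/-! ### Lifting to the universal cover of the plane without two points -/

/-- The Möbius transformation that takes `A` to `0` and `B` to `∞`. -/
def ratio (A B p : ℂ) : ℂ := (p - A) / (p - B)

theorem ratio_ne_zero {A B p : ℂ} (hA : p ≠ A) (hB : p ≠ B) : ratio A B p ≠ 0 :=
  div_ne_zero (sub_ne_zero.2 hA) (sub_ne_zero.2 hB)

theorem inv_ratio (A B p : ℂ) : (ratio A B p)⁻¹ = ratio B A p := inv_div _ _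

theorem ratio_injOn {A B p q : ℂ} (h : A ≠ B) (hp : p ≠ B) (hq : q ≠ B)
    (e : ratio A B p = ratio A B q) : p = q := by
  rw [ratio, ratio, div_eq_div_iff (sub_ne_zero.2 hp) (sub_ne_zero.2 hq)] at e
  have : (p - q) * (A - B) = 0 := by linear_combination e
  rcases mul_eq_zero.1 this with h' | h'
  · exact sub_eq_zero.1 h'
  · exact absurd (sub_eq_zero.1 h') h

theorem continuous_ratio {A B : ℂ} {g : I → ℂ} (hg : Continuous g) (h : ∀ t, g t ≠ B) :
    Continuous fun t => ratio A B (g t) :=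
  (hg.sub continuous_const).div (hg.sub continuous_const) (fun t => sub_ne_zero.2 (h t))

theorem exists_continuous_log_one {g : I → ℂ} (hg : Continuous g) (h0 : ∀ t, g t ≠ 0) {t₀ : I}
    {L : ℂ} (hL : Complex.exp L = g t₀) :
    ∃ l : I → ℂ, Continuous l ∧ l t₀ = L ∧ ∀ t, Complex.exp (l t) = g t := by
  obtain ⟨l, hl, h⟩ := exists_continuous_log hg h0
  refine ⟨fun t => l t + (L - l t₀), by fun_prop, by ring, fun t => ?_⟩
  rw [Complex.exp_add, Complex.exp_sub, h, h, hL, div_self (h0 _), mul_one]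

/-- A final part of a path that starts at zero and does not end at zero avoids zero and starts
close to zero. -/
theorem exists_truncation {g : I → ℂ} (hg : Continuous g) (h0 : g 0 = 0) (h1 : g 1 ≠ 0) {ε : ℝ}
    (hε : 0 < ε) : ∃ r : I → I, Continuous r ∧ r 1 = 1 ∧ (∀ t, g (r t) ≠ 0) ∧ ‖g (r 0)‖ < ε := by
  have hc : IsCompact {t | g t = 0} := (isClosed_singleton.preimage hg).isCompact
  -- The path may return to zero; m is its last zero, and the cut is made just after it.
  obtain ⟨m, hm0, hm⟩ := hc.exists_isGreatest ⟨0, h0⟩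
  have hm0 : g m = 0 := hm0
  have hm1 : m < 1 := lt_of_le_of_ne le_one' (fun e => h1 (e ▸ hm0))
  have hnb : (nhdsWithin m (Set.Ioi m)).NeBot := nhdsGT_neBot_of_exists_gt ⟨1, hm1⟩
  have hev : ∀ᶠ t in nhdsWithin m (Set.Ioi m), ‖g t‖ < ε :=
    (hg.norm.tendsto' m 0 (by rw [hm0, norm_zero])).mono_left nhdsWithin_le_nhds
      |>.eventually_lt_const hε
  obtain ⟨a, ha, ham⟩ := (hev.and self_mem_nhdsWithin).exists
  have ham : m < a := ham
  have hr : ∀ t : I, (a : ℝ) ≤ a + (1 - a) * t ∧ a + (1 - a) * t ≤ (1 : ℝ) := fun t => by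
    have := a.2.2; have := t.2.1; have := t.2.2
    constructor <;> nlinarith
  refine ⟨fun t => ⟨a + (1 - a) * t, a.2.1.trans (hr t).1, (hr t).2⟩, by fun_prop,
    by ext; simp, fun t ht => ?_, by simpa using ha⟩
  have h2 : (⟨a + (1 - a) * t, a.2.1.trans (hr t).1, (hr t).2⟩ : I) ≤ m := hm ht
  have h3 : (a + (1 - a) * t : ℝ) ≤ m := h2
  have h4 : (m : ℝ) < a := ham
  linarith [(hr t).1]

theorem exists_log_truncation {g : I → ℂ} (hg : Continuous g) (h0 : g 0 = 0) {L : ℂ}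
    (hL : Complex.exp L = g 1) (R : ℝ) : ∃ l : I → ℂ, Continuous l ∧ l 1 = L ∧
      (l 0).re ≤ -R ∧ ∀ t, ∃ s, Complex.exp (l t) = g s := by
  obtain ⟨r, hr, hr1, hrn, hr0⟩ := exists_truncation hg h0 (hL ▸ Complex.exp_ne_zero L)
    (Real.exp_pos (-R))
  obtain ⟨l, hl, hl1, h⟩ := exists_continuous_log_one (g := fun t => g (r t)) (t₀ := 1)
    (hg.comp hr) hrn (by rw [hL, hr1])
  refine ⟨l, hl, hl1, ?_, fun t => ⟨r t, h t⟩⟩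
  rw [← h, Complex.norm_exp] at hr0
  exact (Real.exp_lt_exp.1 hr0).le

/-- A path from `A` to `B` with a marked point, divided by it into two paths; the first one does
not pass through `B`, the second one does not pass through `A`. -/
structure MarkedPath (A B : ℂ) where
  α : I → ℂ
  β : I → ℂ
  continuous_α : Continuous α
  continuous_β : Continuous β
  join : α 1 = β 0
  source : α 0 = A
  target : β 1 = B
  α_ne : ∀ t, α t ≠ B
  β_ne : ∀ t, β t ≠ A

namespace MarkedPath

variable {A B : ℂ} {R : ℝ}

/-- The marked path lies over the strip `|re| < R` except near its ends. -/
def Bounded (P : MarkedPath A B) (R : ℝ) : Prop :=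
  (∀ t, ‖ratio A B (P.α t)‖ < Real.exp R) ∧ ∀ t, ‖ratio B A (P.β t)‖ < Real.exp R

/-- The strand `X` lifts the marked path `P` without some parts near the ends. -/
def IsLift (P : MarkedPath A B) (X : Strand R) : Prop :=
  (∀ t, ∃ s, Complex.exp (X.α t) = ratio A B (P.α s)) ∧
    ∀ t, ∃ s, P.β s ≠ B ∧ Complex.exp (X.β t) = ratio A B (P.β s)

theorem exists_isLift (P : MarkedPath A B) (hP : P.Bounded R) {L : ℂ}
    (hL : Complex.exp L = ratio A B (P.α 1)) : ∃ X : Strand R, X.vert = L ∧ P.IsLift X := by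
  obtain ⟨l, hl, hl1, hl0, h⟩ := exists_log_truncation (R := R)
    (continuous_ratio (A := A) P.continuous_α P.α_ne) (by simp [ratio, P.source]) hL
  -- The second part ends at the pole B, so it is reversed and read in the inverse coordinate; the
  -- logarithm is negated afterwards.
  obtain ⟨m, hm, hm1, hm0, h'⟩ := exists_log_truncation (R := R) (L := -L)
    (g := fun t => ratio B A (P.β (σ t)))
    (continuous_ratio (A := B) (P.continuous_β.comp continuous_symm) (fun t => P.β_ne _))
    (by simp [ratio, P.target])
    (by rw [Complex.exp_neg, hL, inv_ratio, P.join, symm_one])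
  refine ⟨⟨l, fun t => -m (σ t), hl, (hm.comp continuous_symm).neg,
    by rw [hl1, symm_zero, hm1, neg_neg], hl0, by rw [symm_one, Complex.neg_re]; linarith,
    fun t => ?_, fun t => ?_⟩, hl1, h, fun t => ?_⟩
  · obtain ⟨s, hs⟩ := h t
    have := hP.1 s
    rw [← hs, Complex.norm_exp] at this
    exact Real.exp_lt_exp.1 this
  · obtain ⟨s, hs⟩ := h' (σ t)
    have := hP.2 (σ s)
    rw [← hs, Complex.norm_exp] at this
    have := Real.exp_lt_exp.1 this
    rw [Complex.neg_re]
    linarith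
  · obtain ⟨s, hs⟩ := h' (σ t)
    refine ⟨σ s, fun e => ?_, ?_⟩
    · rw [e, ratio, sub_self, zero_div] at hs
      exact Complex.exp_ne_zero _ hs
    · rw [Complex.exp_neg, hs, inv_ratio]

theorem exp_add_int_mul (z : ℂ) (k : ℤ) :
    Complex.exp (z + k * (2 * Real.pi * Complex.I)) = Complex.exp z := by
  rw [Complex.exp_add, Complex.exp_int_mul_two_pi_mul_I, mul_one]

theorem lift_α_ne_lift_β (hAB : A ≠ B) {P Q : MarkedPath A B} {X Y : Strand R}
    (hX : P.IsLift X) (hY : Q.IsLift Y) (h : ∀ s t, P.α s ≠ Q.β t) (s t : I) :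
    Complex.exp (X.α s) ≠ Complex.exp (Y.β t) := by
  obtain ⟨s', hs⟩ := hX.1 s
  obtain ⟨t', htB, ht⟩ := hY.2 t
  rw [hs, ht]
  exact fun e => h s' t' (ratio_injOn hAB (P.α_ne _) htB e)

/-- Since exp forgets translations by periods, a forbidden meeting of any translates would project
to one in the original plane. -/
theorem IsLift.periodicCompat (hAB : A ≠ B) {P Q : MarkedPath A B} {X Y : Strand R}
    (hX : P.IsLift X) (hY : Q.IsLift Y) (h : ∀ s t, P.α s ≠ Q.β t) (h' : ∀ s t, Q.α s ≠ P.β t) :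
    X.PeriodicCompat Y := fun k =>
  ⟨fun s t e => lift_α_ne_lift_β hAB hX hY h s t (by
      rw [e]; exact exp_add_int_mul _ k),
    fun s t e => lift_α_ne_lift_β hAB hY hX h' s t (by
      rw [← e]; exact (exp_add_int_mul _ k).symm)⟩

/-- The path `γ` avoids both ends and lies over the strip `|re| < R`. -/
structure BoundedPath (A B : ℂ) (R : ℝ) (γ : I → ℂ) : Prop where
  continuous : Continuous γ
  ne_left : ∀ t, γ t ≠ A
  ne_right : ∀ t, γ t ≠ B
  lt_right : ∀ t, ‖ratio A B (γ t)‖ < Real.exp R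
  lt_left : ∀ t, ‖ratio B A (γ t)‖ < Real.exp R

theorem BoundedPath.exists_lift {γ : I → ℂ} (h : BoundedPath A B R γ) {L : ℂ}
    (hL : Complex.exp L = ratio A B (γ 0)) : ∃ l : I → ℂ, Continuous l ∧ l 0 = L ∧
      l 1 = L + logVar (fun t => ratio A B (γ t)) ∧
      (∀ t, Complex.exp (l t) = ratio A B (γ t)) ∧ (∀ t, -R < (l t).re) ∧ ∀ t, (l t).re < R := by
  obtain ⟨l, hl, hl0, he⟩ := exists_continuous_log_one (t₀ := 0)
    (continuous_ratio (A := A) h.continuous h.ne_right)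
    (fun t => ratio_ne_zero (h.ne_left t) (h.ne_right t)) hL
  refine ⟨l, hl, hl0, ?_, he, fun t => ?_, fun t => ?_⟩
  · rw [logVar_eq hl he, hl0]; ring
  · have := h.lt_left t
    rw [← inv_ratio, ← he, ← Complex.exp_neg, Complex.norm_exp] at this
    have := Real.exp_lt_exp.1 this
    rw [Complex.neg_re] at this
    linarith
  · have := h.lt_right t
    rw [← he, Complex.norm_exp] at this
    exact Real.exp_lt_exp.1 this

theorem IsLift.joinedOff (hAB : A ≠ B) {P : MarkedPath A B} {X : Strand R} (hX : P.IsLift X)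
    {γ l : I → ℂ} (h : BoundedPath A B R γ) (hl : Continuous l)
    (he : ∀ t, Complex.exp (l t) = ratio A B (γ t)) (hl1 : ∀ t, -R < (l t).re)
    (hl2 : ∀ t, (l t).re < R) (hα : ∀ s t, P.α s ≠ γ t) (hβ : ∀ s t, P.β s ≠ γ t) :
    X.JoinedOff (l 0) (l 1) := by
  refine ⟨l, hl, rfl, rfl, hl1, hl2, fun k t => ⟨fun s e => ?_, fun s e => ?_⟩⟩
  · obtain ⟨s', hs⟩ := hX.1 s
    have e1 : Complex.exp (X.α s) = Complex.exp (l t) := by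
      rw [← e]; exact (exp_add_int_mul _ k).symm
    rw [hs, he] at e1
    exact hα _ _ (ratio_injOn hAB (P.α_ne _) (h.ne_right t) e1)
  · obtain ⟨s', hsB, hs⟩ := hX.2 s
    have e1 : Complex.exp (X.β s) = Complex.exp (l t) := by
      rw [← e]; exact (exp_add_int_mul _ k).symm
    rw [hs, he] at e1
    exact hβ _ _ (ratio_injOn hAB hsB (h.ne_right t) e1)

theorem eventually_norm_lt {g : I → ℂ} (hg : Continuous g) :
    ∀ᶠ R in Filter.atTop, ∀ t, ‖g t‖ < Real.exp R := by
  obtain ⟨C, hC⟩ := Strand.exists_norm_sub_le hg 0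
  filter_upwards [Filter.eventually_ge_atTop C] with R hR t
  have := hC t
  rw [sub_zero] at this
  linarith [Real.add_one_le_exp R]

theorem eventually_bounded (P : MarkedPath A B) : ∀ᶠ R in Filter.atTop, P.Bounded R :=
  (eventually_norm_lt (continuous_ratio P.continuous_α P.α_ne)).and
    (eventually_norm_lt (continuous_ratio P.continuous_β P.β_ne))

theorem eventually_boundedPath {γ : I → ℂ} (hγ : Continuous γ) (hA : ∀ t, γ t ≠ A)
    (hB : ∀ t, γ t ≠ B) : ∀ᶠ R in Filter.atTop, BoundedPath A B R γ := by
  filter_upwards [eventually_norm_lt (continuous_ratio (A := A) hγ hB),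
    eventually_norm_lt (continuous_ratio (A := B) hγ hA)] with R h1 h2
  exact ⟨hγ, hA, hB, h1, h2⟩

/-- Two marked paths are compatible if the first part of each of them is disjoint from the second
part of the other one. -/
def Compat (P Q : MarkedPath A B) : Prop := (∀ s t, P.α s ≠ Q.β t) ∧ ∀ s t, Q.α s ≠ P.β t

/-- A path joins the marked points of `P` and `Q` off `A`, `B` and the marked path `S`. -/
structure IsSide (P Q S : MarkedPath A B) (γ : I → ℂ) : Prop where
  continuous : Continuous γ
  zero : γ 0 = P.α 1
  one : γ 1 = Q.α 1
  ne_left : ∀ t, γ t ≠ A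
  ne_right : ∀ t, γ t ≠ B
  α_ne : ∀ s t, S.α s ≠ γ t
  β_ne : ∀ s t, S.β s ≠ γ t

theorem exists_logVar_triangle_eq (hAB : A ≠ B) {P Q S : MarkedPath A B} (hPQ : P.Compat Q)
    (hQS : Q.Compat S) (hSP : S.Compat P) {γ₁ γ₂ γ₃ : I → ℂ} (h₁ : IsSide P Q S γ₁)
    (h₂ : IsSide Q S P γ₂) (h₃ : IsSide S P Q γ₃) :
    ∃ d : ℤ, (d = 1 ∨ d = -1) ∧ logVar (fun t => ratio A B (γ₁ t)) +
      logVar (fun t => ratio A B (γ₂ t)) + logVar (fun t => ratio A B (γ₃ t)) =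
        d * (2 * Real.pi * Complex.I) := by
  obtain ⟨R, bP, bQ, bS, b₁, b₂, b₃⟩ := (P.eventually_bounded.and (Q.eventually_bounded.and
    (S.eventually_bounded.and ((eventually_boundedPath h₁.continuous h₁.ne_left h₁.ne_right).and
    ((eventually_boundedPath h₂.continuous h₂.ne_left h₂.ne_right).and
    (eventually_boundedPath h₃.continuous h₃.ne_left h₃.ne_right)))))).exists
  have hP0 : ratio A B (P.α 1) ≠ 0 := by
    rw [← h₁.zero]; exact ratio_ne_zero (h₁.ne_left 0) (h₁.ne_right 0)
  have hL₀ := Complex.exp_log hP0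
  obtain ⟨l₁, cl₁, l₁0, l₁1, e₁, lb₁, ub₁⟩ := b₁.exists_lift (by rw [h₁.zero]; exact hL₀)
  obtain ⟨l₂, cl₂, l₂0, l₂1, e₂, lb₂, ub₂⟩ := b₂.exists_lift (L := l₁ 1)
    (by rw [e₁, h₁.one, h₂.zero])
  obtain ⟨l₃, cl₃, l₃0, l₃1, e₃, lb₃, ub₃⟩ := b₃.exists_lift (L := l₂ 1)
    (by rw [e₂, h₂.one, h₃.zero])
  obtain ⟨X, hX, lX⟩ := P.exists_isLift bP hL₀
  obtain ⟨Y, hY, lY⟩ := Q.exists_isLift bQ (L := l₁ 1) (by rw [e₁, h₁.one])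
  obtain ⟨Z, hZ, lZ⟩ := S.exists_isLift bS (L := l₂ 1) (by rw [e₂, h₂.one])
  -- The three sides are lifted end to end; d measures the failure of the lifted triangle to close.
  obtain ⟨d, hd⟩ := Complex.exp_eq_exp_iff_exists_int.1
    (show Complex.exp (l₃ 1) = Complex.exp (Complex.log (ratio A B (P.α 1))) by
      rw [e₃, h₃.one, hL₀])
  refine ⟨d, ?_, ?_⟩
  · have j₁ := lZ.joinedOff hAB b₁ cl₁ e₁ lb₁ ub₁ h₁.α_ne h₁.β_ne
    have j₂ := lX.joinedOff hAB b₂ cl₂ e₂ lb₂ ub₂ h₂.α_ne h₂.β_ne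
    have j₃ := lY.joinedOff hAB b₃ cl₃ e₃ lb₃ ub₃ h₃.α_ne h₃.β_ne
    rw [l₁0, ← hX, ← hY] at j₁
    rw [l₂0, ← hY, ← hZ] at j₂
    rw [l₃0, ← hZ, hd, ← hX, ← Strand.shift_vert] at j₃
    exact Strand.period_eq_one_or_neg_one (lX.periodicCompat hAB lY hPQ.1 hPQ.2)
      (lY.periodicCompat hAB lZ hQS.1 hQS.2) (lZ.periodicCompat hAB lX hSP.1 hSP.2) j₂ j₁ j₃
  · linear_combination hd - l₁1 - l₂1 - l₃1

end MarkedPath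

/-! ### Polygonal lines as paths -/

/-- The sum of the oriented angles `∠A₁OA₂, …, ∠A_{m-1}OA_m` of a polygonal line. -/
def polygonalAngle (l : List ℂ) (O : ℂ) : ℝ :=
  (List.zipWith (fun A B => orientedAngle A O B) l l.tail).sum

theorem polygonalAngle_cons_cons (a b : ℂ) (l : List ℂ) (O : ℂ) :
    polygonalAngle (a :: b :: l) O = orientedAngle a O b + polygonalAngle (b :: l) O := by
  simp [polygonalAngle]

theorem polygonalAngle_append (l m : List ℂ) (b O : ℂ) :
    polygonalAngle (l ++ b :: m) O = polygonalAngle (l ++ [b]) O + polygonalAngle (b :: m) O := by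
  induction l with
  | nil => simp [polygonalAngle]
  | cons a l ih =>
    cases l with
    | nil => simp [polygonalAngle]
    | cons c l =>
      simp only [List.cons_append, polygonalAngle_cons_cons] at ih ⊢
      rw [ih, add_assoc]

theorem polygonalAngle_cons_append (a : ℂ) (l m : List ℂ) (b O : ℂ) :
    polygonalAngle (a :: (l ++ b :: m)) O =
      polygonalAngle (a :: (l ++ [b])) O + polygonalAngle (b :: m) O :=
  polygonalAngle_append (a :: l) m b O

theorem polygonalImage_cons_cons (a b : ℂ) (l : List ℂ) :
    polygonalImage (a :: b :: l) = segment ℝ a b ∪ polygonalImage (b :: l) := by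
  ext x
  simp [polygonalImage]

theorem polygonalWinding_cons (a : ℂ) (l : List ℂ) (O : ℂ) :
    polygonalWinding (a :: l) O = polygonalAngle (a :: (l ++ [a])) O / (2 * Real.pi) := by
  have h : ∀ (f : ℂ → ℂ → ℝ) (x y : List ℂ) (z : ℂ), x.length = y.length →
      List.zipWith f (x ++ [z]) y = List.zipWith f x y := fun f x => by
    induction x with
    | nil => intro y z h; simp [List.eq_nil_of_length_eq_zero h.symm]
    | cons b x ih =>
      intro y z h
      cases y with
      | nil => simp at h
      | cons c y => simp [ih y z (by simpa using h)]
  rw [polygonalWinding, polygonalAngle, List.rotate_cons_succ, List.rotate_zero, List.tail_cons,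
    ← List.cons_append, h _ _ _ _ (by simp)]

/-- After division by a - O the segment avoids the closed negative axis: a value r ≤ 0 would make O
a convex combination of a and a point of the segment. -/
theorem logVar_segment {a b O : ℂ} (h : O ∉ segment ℝ a b) :
    (logVar fun t => Path.segment a b t - O).im = orientedAngle a O b := by
  have mem : ∀ t, Path.segment a b t ∈ segment ℝ a b := fun t => by
    rw [← Path.range_segment]; exact ⟨t, rfl⟩
  have h0 : ∀ t, Path.segment a b t - O ≠ 0 := fun t e => h (sub_eq_zero.1 e ▸ mem t)
  have ha : a - O ≠ 0 := fun e => h (sub_eq_zero.1 e ▸ left_mem_segment ℝ a b)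
  have cont : Continuous fun t => Path.segment a b t - O :=
    (Path.continuous _).sub continuous_const
  rw [← logVar_const_mul (inv_ne_zero ha) cont h0,
    logVar_of_mem_slitPlane (g := fun t => (a - O)⁻¹ * (Path.segment a b t - O)) (by fun_prop)]
  · rw [Path.source, Path.target, inv_mul_cancel₀ ha, Complex.log_one, sub_zero, Complex.log_im,
      orientedAngle, div_eq_inv_mul]
  · intro t
    by_contra hs
    rw [Complex.mem_slitPlane_iff, not_or, not_lt, not_not] at hs
    obtain ⟨hre, him⟩ := hs
    set r : ℝ := ((a - O)⁻¹ * (Path.segment a b t - O)).re with hr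
    have e1 : (a - O)⁻¹ * (Path.segment a b t - O) = r :=
      Complex.ext (by simp [hr]) (by simpa using him)
    have e2 : Path.segment a b t - O = r * (a - O) := by
      rw [← e1]; field_simp
    have hr1 : (0 : ℝ) < 1 - r := by linarith
    have hr2 : (1 - r : ℂ) ≠ 0 := by exact_mod_cast hr1.ne'
    apply h
    have e3 : O = (-r / (1 - r)) • a + (1 / (1 - r)) • Path.segment a b t := by
      rw [Complex.real_smul, Complex.real_smul]
      push_cast
      field_simp
      linear_combination -e2
    rw [e3]
    exact (convex_segment a b) (left_mem_segment ℝ a b) (mem t)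
      (div_nonneg (by linarith) hr1.le) (by positivity) (by field_simp; ring)

theorem exists_path_polygonal (l : List ℂ) (a b : ℂ) : ∃ γ : Path a b,
    Set.range γ = polygonalImage (a :: (l ++ [b])) ∧
    ∀ O, O ∉ polygonalImage (a :: (l ++ [b])) →
      (logVar fun t => γ t - O).im = polygonalAngle (a :: (l ++ [b])) O := by
  induction l generalizing a with
  | nil =>
    have h : polygonalImage [a, b] = segment ℝ a b := by simp [polygonalImage]
    refine ⟨Path.segment a b, by rw [Path.range_segment]; exact h.symm, fun O hO => ?_⟩
    rw [logVar_segment (fun h' => hO (h.symm ▸ h'))]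
    simp [polygonalAngle]
  | cons c l ih =>
    obtain ⟨γ, hγ, hO⟩ := ih c
    rw [List.cons_append, polygonalImage_cons_cons]
    refine ⟨(Path.segment a c).trans γ, by rw [Path.trans_range, Path.range_segment, hγ],
      fun O h => ?_⟩
    rw [Set.mem_union, not_or] at h
    rw [logVar_path_trans, Complex.add_im, hO O h.2, logVar_segment h.1, polygonalAngle_cons_cons]
    · exact fun t e => h.1 (by rw [← Path.range_segment]; exact ⟨t, e⟩)
    · exact fun t e => h.2 (by rw [← hγ]; exact ⟨t, e⟩)

namespace PLMap

variable {V : Type*} {G : SimpleGraph V}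

/-- The restriction of the map to an oriented edge, as a continuous path. -/
def path (f : PLMap G) (d : G.Dart) : Path (f.pos d.fst) (f.pos d.snd) :=
  (exists_path_polygonal (f.inner d) (f.pos d.fst) (f.pos d.snd)).choose

theorem path_mem_edgeImage (f : PLMap G) (d : G.Dart) (t : I) : f.path d t ∈ f.edgeImage d := by
  rw [edgeImage, line,
    ← (exists_path_polygonal (f.inner d) (f.pos d.fst) (f.pos d.snd)).choose_spec.1]
  exact ⟨t, rfl⟩

theorem logVar_path (f : PLMap G) (d : G.Dart) {O : ℂ} (h : O ∉ f.edgeImage d) :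
    (logVar fun t => f.path d t - O).im = polygonalAngle (f.line d) O :=
  (exists_path_polygonal (f.inner d) (f.pos d.fst) (f.pos d.snd)).choose_spec.2 O h

theorem path_ne {f : PLMap G} {d : G.Dart} {O : ℂ} (h : O ∉ f.edgeImage d) (t : I) :
    f.path d t ≠ O := fun e => h (e ▸ f.path_mem_edgeImage d t)

namespace IsAlmostEmbedding

variable {f : PLMap G}

theorem pos_notMem (hf : f.IsAlmostEmbedding) {v : V} {d : G.Dart} (h₁ : v ≠ d.fst) (h₂ : v ≠ d.snd) :
    f.pos v ∉ f.edgeImage d :=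
  hf.vertex_edge v d fun h => by
    rcases Sym2.mem_iff.1 h with h | h
    exacts [h₁ h, h₂ h]

theorem path_ne_path (hf : f.IsAlmostEmbedding) {d e : G.Dart} (h₁ : d.fst ≠ e.fst)
    (h₂ : d.fst ≠ e.snd) (h₃ : d.snd ≠ e.fst) (h₄ : d.snd ≠ e.snd) (s t : I) : f.path d s ≠ f.path e t := by
  refine (hf.edge_edge d e fun v hd he => ?_).ne_of_mem (f.path_mem_edgeImage d s)
    (f.path_mem_edgeImage e t)
  rcases Sym2.mem_iff.1 hd with rfl | rfl <;> rcases Sym2.mem_iff.1 he with h | h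
  exacts [h₁ h, h₂ h, h₃ h, h₄ h]

end IsAlmostEmbedding

end PLMap

/-! ### Almost embeddings of `K₅` without an edge -/

theorem K5minus45_adj_3 {i : Fin 5} (h3 : i ≠ 3) (h4 : i ≠ 4) : K5minus45.Adj 3 i := by
  simp [K5minus45, h3.symm, h4]

theorem K5minus45_adj_4 {i : Fin 5} (h3 : i ≠ 3) (h4 : i ≠ 4) : K5minus45.Adj i 4 := by
  simp [K5minus45, h3, h4]

namespace PLMap.IsAlmostEmbedding

variable {f : PLMap K5minus45}

/-- The path from the vertex `3` to the vertex `4` through the vertex `i`. -/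
def markedPath (hf : f.IsAlmostEmbedding) {i : Fin 5} (h3 : i ≠ 3) (h4 : i ≠ 4) :
    MarkedPath (f.pos 3) (f.pos 4) where
  α := f.path ⟨(3, i), K5minus45_adj_3 h3 h4⟩
  β := f.path ⟨(i, 4), K5minus45_adj_4 h3 h4⟩
  continuous_α := Path.continuous _
  continuous_β := Path.continuous _
  join := (Path.target _).trans (Path.source _).symm
  source := Path.source _
  target := Path.target _
  α_ne := path_ne (hf.pos_notMem (d := ⟨(3, i), _⟩) (show (4 : Fin 5) ≠ 3 by decide) h4.symm)
  β_ne := path_ne (hf.pos_notMem (d := ⟨(i, 4), _⟩) h3.symm (show (3 : Fin 5) ≠ 4 by decide))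

theorem markedPath_compat (hf : f.IsAlmostEmbedding) {i j : Fin 5} (hi3 : i ≠ 3) (hi4 : i ≠ 4)
    (hj3 : j ≠ 3) (hj4 : j ≠ 4) (hij : i ≠ j) :
    (hf.markedPath hi3 hi4).Compat (hf.markedPath hj3 hj4) :=
  ⟨hf.path_ne_path (d := ⟨(3, i), _⟩) (e := ⟨(j, 4), _⟩) hj3.symm
      (show (3 : Fin 5) ≠ 4 by decide) hij hi4,
    hf.path_ne_path (d := ⟨(3, j), _⟩) (e := ⟨(i, 4), _⟩) hi3.symm
      (show (3 : Fin 5) ≠ 4 by decide) hij.symm hj4⟩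

theorem isSide_path (hf : f.IsAlmostEmbedding) {i j k : Fin 5} (hi3 : i ≠ 3) (hi4 : i ≠ 4)
    (hj3 : j ≠ 3) (hj4 : j ≠ 4) (hk3 : k ≠ 3) (hk4 : k ≠ 4) (hki : k ≠ i) (hkj : k ≠ j)
    (h : K5minus45.Adj i j) :
    MarkedPath.IsSide (hf.markedPath hi3 hi4) (hf.markedPath hj3 hj4) (hf.markedPath hk3 hk4)
      (f.path ⟨(i, j), h⟩) where
  continuous := Path.continuous _
  zero := (Path.source _).trans (Path.target _).symm
  one := (Path.target _).trans (Path.target _).symm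
  ne_left := path_ne (hf.pos_notMem (d := ⟨(i, j), h⟩) hi3.symm hj3.symm)
  ne_right := path_ne (hf.pos_notMem (d := ⟨(i, j), h⟩) hi4.symm hj4.symm)
  α_ne := hf.path_ne_path (d := ⟨(3, k), _⟩) (e := ⟨(i, j), h⟩) hi3.symm hj3.symm hki hkj
  β_ne := hf.path_ne_path (d := ⟨(k, 4), _⟩) (e := ⟨(i, j), h⟩) hki hkj hi4.symm hj4.symm

end PLMap.IsAlmostEmbedding

theorem cycle123_darts : cycle123.darts =
    [⟨(0, 1), K5minus45_adj_01⟩, ⟨(1, 2), K5minus45_adj_12⟩, ⟨(2, 0), K5minus45_adj_20⟩] := rfl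

theorem PLMap.polygonalWinding_closedLine (f : PLMap K5minus45) (O : ℂ) :
    polygonalWinding (f.closedLine cycle123) O =
      (polygonalAngle (f.line ⟨(0, 1), K5minus45_adj_01⟩) O +
        polygonalAngle (f.line ⟨(1, 2), K5minus45_adj_12⟩) O +
        polygonalAngle (f.line ⟨(2, 0), K5minus45_adj_20⟩) O) / (2 * Real.pi) := by
  have h : ∀ d : K5minus45.Dart, (f.line d).dropLast = f.pos d.fst :: f.inner d := fun d => by
    rw [PLMap.line, ← List.cons_append, List.dropLast_concat]
  rw [PLMap.closedLine, cycle123_darts]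
  simp only [List.flatMap_cons, List.flatMap_nil, h, List.append_nil, List.cons_append]
  rw [polygonalWinding_cons]
  congr 1
  simp only [PLMap.line, List.append_assoc, List.cons_append]
  rw [polygonalAngle_cons_append (f.pos 0),
    polygonalAngle_cons_append (f.pos 1) _ (f.inner _ ++ [f.pos 0]), add_assoc]

/-- The winding number of the cycle in terms of the variation of the logarithm. -/
theorem PLMap.exists_winding_eq (f : PLMap K5minus45) {u : Fin 5}
    (h : f.pos u ∉ f.cycleImage cycle123) : ∃ w : ℤ, f.winding cycle123 u = w ∧
      logVar (fun t => f.path ⟨(0, 1), K5minus45_adj_01⟩ t - f.pos u) +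
        logVar (fun t => f.path ⟨(1, 2), K5minus45_adj_12⟩ t - f.pos u) +
        logVar (fun t => f.path ⟨(2, 0), K5minus45_adj_20⟩ t - f.pos u) =
      w * (2 * Real.pi * Complex.I) := by
  have h' : ∀ d ∈ cycle123.darts, f.pos u ∉ f.edgeImage d := fun d hd hm => h ⟨d, hd, hm⟩
  simp only [cycle123_darts, List.forall_mem_cons] at h'
  obtain ⟨h₁, h₂, h₃, -⟩ := h'
  have e : ∀ {d}, f.pos u ∉ f.edgeImage d →
      Complex.exp (logVar fun t => f.path d t - f.pos u) =
        (f.pos d.snd - f.pos u) / (f.pos d.fst - f.pos u) ∧ f.pos d.fst - f.pos u ≠ 0 :=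
    fun {d} hd => by
      have h0 : ∀ t, f.path d t - f.pos u ≠ 0 := fun t => sub_ne_zero.2 (PLMap.path_ne hd t)
      refine ⟨?_, by simpa using h0 0⟩
      rw [exp_logVar (g := fun t => f.path d t - f.pos u)
        ((Path.continuous _).sub continuous_const) h0, Path.source, Path.target]
  obtain ⟨e₁, n₁⟩ := e h₁
  obtain ⟨e₂, n₂⟩ := e h₂
  obtain ⟨e₃, n₃⟩ := e h₃
  obtain ⟨w, hw⟩ := Complex.exp_eq_one_iff.1
    (show Complex.exp (logVar (fun t => f.path ⟨(0, 1), K5minus45_adj_01⟩ t - f.pos u) +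
        logVar (fun t => f.path ⟨(1, 2), K5minus45_adj_12⟩ t - f.pos u) +
        logVar (fun t => f.path ⟨(2, 0), K5minus45_adj_20⟩ t - f.pos u)) = 1 by
      rw [Complex.exp_add, Complex.exp_add, e₁, e₂, e₃]
      field_simp)
  refine ⟨w, ?_, hw⟩
  rw [PLMap.winding, f.polygonalWinding_closedLine, ← f.logVar_path _ h₁, ← f.logVar_path _ h₂,
    ← f.logVar_path _ h₃, ← Complex.add_im, ← Complex.add_im, hw,
    div_eq_iff Real.two_pi_pos.ne']
  simp

end

theorem theorem5p5 (f : PLMap K5minus45) (hf : f.IsAlmostEmbedding) :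
    f.pos 3 ∉ f.cycleImage cycle123 ∧ f.pos 4 ∉ f.cycleImage cycle123 ∧
    ∃ w₄ w₅ : ℤ, f.winding cycle123 3 = w₄ ∧ f.winding cycle123 4 = w₅ ∧
      w₄ - w₅ ≡ 1 [ZMOD 2] ∧
      (w₄ - w₅ = 1 ∨ w₄ - w₅ = -1) := by
  have off : ∀ u : Fin 5, u ≠ 0 → u ≠ 1 → u ≠ 2 → f.pos u ∉ f.cycleImage cycle123 := by
    rintro u h0 h1 h2 ⟨d, hd, hm⟩
    rw [cycle123_darts] at hd
    simp only [List.mem_cons, List.not_mem_nil, or_false] at hd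
    rcases hd with rfl | rfl | rfl
    exacts [hf.pos_notMem h0 h1 hm, hf.pos_notMem h1 h2 hm, hf.pos_notMem h2 h0 hm]
  have off3 := off 3 (by decide) (by decide) (by decide)
  have off4 := off 4 (by decide) (by decide) (by decide)
  obtain ⟨w₄, hw₄, e₄⟩ := f.exists_winding_eq off3
  obtain ⟨w₅, hw₅, e₅⟩ := f.exists_winding_eq off4
  have s₁ := hf.isSide_path (i := 0) (j := 1) (k := 2) (by decide) (by decide) (by decide)
    (by decide) (by decide) (by decide) (by decide) (by decide) K5minus45_adj_01
  have s₂ := hf.isSide_path (i := 1) (j := 2) (k := 0) (by decide) (by decide) (by decide)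
    (by decide) (by decide) (by decide) (by decide) (by decide) K5minus45_adj_12
  have s₃ := hf.isSide_path (i := 2) (j := 0) (k := 1) (by decide) (by decide) (by decide)
    (by decide) (by decide) (by decide) (by decide) (by decide) K5minus45_adj_20
  obtain ⟨d, hd, e⟩ := MarkedPath.exists_logVar_triangle_eq
    (hf.vertex_vertex 3 4 (by decide))
    (hf.markedPath_compat _ _ _ _ (by decide)) (hf.markedPath_compat _ _ _ _ (by decide))
    (hf.markedPath_compat _ _ _ _ (by decide)) s₁ s₂ s₃
  have hdiv : ∀ {γ : unitInterval → ℂ}, Continuous γ → (∀ t, γ t ≠ f.pos 3) →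
      (∀ t, γ t ≠ f.pos 4) → logVar (fun t => ratio (f.pos 3) (f.pos 4) (γ t)) =
        logVar (fun t => γ t - f.pos 3) - logVar (fun t => γ t - f.pos 4) :=
    fun hγ h3 h4 => logVar_div (hγ.sub continuous_const) (fun t => sub_ne_zero.2 (h3 t))
      (hγ.sub continuous_const) (fun t => sub_ne_zero.2 (h4 t))
  rw [hdiv s₁.continuous s₁.ne_left s₁.ne_right, hdiv s₂.continuous s₂.ne_left s₂.ne_right,
    hdiv s₃.continuous s₃.ne_left s₃.ne_right] at e
  -- The logarithm of the ratio varies along the triangle by the difference of the variations about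
  -- f(4) and f(5).
  have key : w₄ - w₅ = d := by
    have : ((w₄ - w₅ : ℤ) : ℂ) * (2 * Real.pi * Complex.I) = d * (2 * Real.pi * Complex.I) := by
      rw [← e]
      push_cast
      linear_combination -e₄ + e₅
    exact_mod_cast mul_right_cancel₀ Complex.two_pi_I_ne_zero this
  refine ⟨off3, off4, w₄, w₅, hw₄, hw₅, ?_, key ▸ hd⟩
  rw [key]
  rcases hd with rfl | rfl <;> decide
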